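/- **Setting.** Let $\mathcal C$ be a set of $m$ candidates and $\mathcal V$ a set of $n\ge 1$ voters; each voter $v$ reports a linear order $\succ_v$ on $\mathcal C$. A scoring rule $r$ is given by a vector $\alpha=(\alpha_1,\dots,\alpha_m)\in\mathbb Q^m$ with $\alpha_1\ge\alpha_2\ge\dots\ge\alpha_m$ and $\alpha_1>\alpha_m$, and a linear order $\succ_t$ on $\mathcal C$: a candidate gets $\alpha_i$ points from every vote that places it at position $i$, and $r$ returns, among the candidates with maximum total score, the one that is first in $\succ_t$. For a profile $(\succ_v)_{v\in\mathcal V}$ with winner $x=r((\succ_v)_{v\in\mathcal V})$ and a candidate $y$, a set $M\subseteq\mathcal V$ is a *coalition of possible manipulators against $y$* if $y\ne x$ and there are linear orders $(\succ'_j)_{j\in M}$ with $x\succ'_j y$ for all $j\in M$ and $r\big((\succ_v)_{v\in\mathcal V\setminus M},(\succ'_j)_{j\in M}\big)=y$. It is a *coalition of possible manipulators* if it is one against some candidate $y$. Consider the following decision problems, in which the rule $(\alpha,\succ_t)$ and the profile $(\succ_v)_{v\in\mathcal V}$ are part of the input. * **CPMW**: given also $M\subseteq\mathcal V$ and $y\in\mathcal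 C$, is $M$ a coalition of possible manipulators against $y$? * **CPM**: given also $M\subseteq\mathcal V$, is $M$ a coalition of possible manipulators? * **CPMSW**: given also $y\in\mathcal C$ and an integer $k$, is there $M\subseteq\mathcal V$ with $|M|\le k$ that is a coalition of possible manipulators against $y$? * **CPMS**: given also an integer $k$, is there $M\subseteq\mathcal V$ with $|M|\le k$ that is a coalition of possible manipulators? The entries of $\alpha$ are written as integers over their least common denominator; all numbers and candidate names are written in binary, a linear order as the list of the candidates from first to last, and $M$ as its characteristic vector. **Theorem.** CPMW and CPM restricted to instances with $|M|=1$, and CPMSW and CPMS restricted to instances with $k=1$, can be decided in polynomial time: for each of the four problems there are a Turing machine and a polynomial $p$ such that on every instance, encoded by a string of length $\ell$, the machine halts with the correct answer after at most $p(\ell)$ steps. -/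

import Mathlib

namespace PossibleManipulators

/-! ### Elections -/

/-- A preference (linear order) over the `m` candidates, given as the bijection that sends a
candidate to its position; position `0` is the top position. -/
abbrev Preference (m : ℕ) : Type := Equiv.Perm (Fin m)

/-- Candidate `a` is weakly preferred to candidate `b`. -/
def Preference.Prefers {m : ℕ} (p : Preference m) (a b : Fin m) : Prop := p a ≤ p b

/-- The preferences of `n` voters over `m` candidates. -/
abbrev Profile (m n : ℕ) : Type := Fin n → Preference m

/-- A (resolute) voting rule for `n` voters and `m` candidates. -/
abbrev VotingRule (m n : ℕ) : Type := Profile m n → Fin m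

/-- The score of candidate `c`: the vote of `v` contributes the entry of the scoring vector `α`
at the position of `c` in that vote. -/
def score {m n : ℕ} (α : Fin m → ℚ) (P : Profile m n) (c : Fin m) : ℚ :=
  ∑ v, α (P v c)

/-- The candidates of maximum score. -/
def coWinners {m n : ℕ} (α : Fin m → ℚ) (P : Profile m n) : Finset (Fin m) :=
  Finset.univ.filter fun c => ∀ d, score α P d ≤ score α P c

theorem coWinners_nonempty {m n : ℕ} (hm : 0 < m) (α : Fin m → ℚ) (P : Profile m n) :
    (coWinners α P).Nonempty := by
  obtain ⟨c, -, hc⟩ := Finset.exists_max_image Finset.univ (score α P) ⟨⟨0, hm⟩, Finset.mem_univ _⟩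
  exact ⟨c, by simpa [coWinners] using hc⟩

/-- Lexicographic tie-breaking: the element of `S` that comes first in the preference `t`. -/
def tieBreak {m : ℕ} (t : Preference m) (S : Finset (Fin m)) (hS : S.Nonempty) : Fin m :=
  t.symm ((S.image t).min' (hS.image t))

/-- The positional scoring rule with scoring vector `α` and lexicographic tie-breaking
according to `t`. -/
def scoringRule {m : ℕ} (hm : 0 < m) (α : Fin m → ℚ) (t : Preference m) (n : ℕ) :
    VotingRule m n :=
  fun P => tieBreak t (coWinners α P) (coWinners_nonempty hm α P)

/-! ### Coalitions of possible manipulators -/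

/-- The profile in which the voters in `M` vote according to `Q` and all others according
to `P`. -/
def replaceVotes {m n : ℕ} (P : Profile m n) (M : Finset (Fin n)) (Q : M → Preference m) :
    Profile m n :=
  fun v => if h : v ∈ M then Q ⟨v, h⟩ else P v

/-- `M` is a coalition of possible manipulators against `y`; the current winner is `r P`. -/
def IsCoalitionAgainst {m n : ℕ} (r : VotingRule m n) (P : Profile m n) (M : Finset (Fin n))
    (y : Fin m) : Prop :=
  y ≠ r P ∧ ∃ Q : M → Preference m, (∀ j, (Q j).Prefers (r P) y) ∧ r (replaceVotes P M Q) = y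

/-- `M` is a coalition of possible manipulators. -/
def IsCoalition {m n : ℕ} (r : VotingRule m n) (P : Profile m n) (M : Finset (Fin n)) : Prop :=
  ∃ y, IsCoalitionAgainst r P M y

/-! ### Instances of the four problems for scoring rules -/

/-- A scoring rule (a nonincreasing, nonconstant scoring vector with rational entries and a
tie-breaking order) together with a preference profile. -/
structure Election where
  /-- number of candidates -/
  m : ℕ
  /-- number of voters -/
  n : ℕ
  m_pos : 0 < m
  n_pos : 0 < n
  /-- scoring vector -/
  α : Fin m → ℚ
  α_antitone : Antitone α
  α_last_lt_first : α ⟨m - 1, Nat.sub_one_lt_of_lt m_pos⟩ < α ⟨0, m_pos⟩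
  /-- tie-breaking order -/
  tie : Preference m
  /-- reported votes -/
  profile : Profile m n

/-- The voting rule of an election. -/
def Election.rule (E : Election) : VotingRule E.m E.n := scoringRule E.m_pos E.α E.tie E.n

/-- Coalitional Possible Manipulators given Winner: instances. -/
structure CPMW extends Election where
  /-- suspected coalition -/
  M : Finset (Fin n)
  /-- actual winner -/
  y : Fin m

/-- Yes-instances of CPMW. -/
def CPMW.IsYes (I : CPMW) : Prop := IsCoalitionAgainst I.rule I.profile I.M I.y

/-- Coalitional Possible Manipulators: instances. -/
structure CPM extends Election where
  /-- suspected coalition -/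
  M : Finset (Fin n)

/-- Yes-instances of CPM. -/
def CPM.IsYes (I : CPM) : Prop := IsCoalition I.rule I.profile I.M

/-- Coalitional Possible Manipulators Search given Winner: instances. -/
structure CPMSW extends Election where
  /-- actual winner -/
  y : Fin m
  /-- maximum coalition size -/
  k : ℕ

/-- Yes-instances of CPMSW. -/
def CPMSW.IsYes (I : CPMSW) : Prop :=
  ∃ M : Finset (Fin I.n), M.card ≤ I.k ∧ IsCoalitionAgainst I.rule I.profile M I.y

/-- Coalitional Possible Manipulators Search: instances. -/
structure CPMS extends Election where
  /-- maximum coalition size -/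
  k : ℕ

/-- Yes-instances of CPMS. -/
def CPMS.IsYes (I : CPMS) : Prop :=
  ∃ M : Finset (Fin I.n), M.card ≤ I.k ∧ IsCoalition I.rule I.profile M

/-! ### Encoding of instances as strings -/

/-- The input alphabet: binary digits, a minus sign, an end mark for numbers and an end mark for
blocks. -/
inductive Letter where
  | bit (b : Bool)
  | minus
  | endNum
  | endBlock
  deriving DecidableEq, Fintype

/-- A natural number in binary. -/
def encNat (k : ℕ) : List Letter := (Computability.encodeNat k).map Letter.bit ++ [Letter.endNum]

/-- An integer: sign and absolute value in binary. -/
def encInt (z : ℤ) : List Letter := (if z < 0 then [Letter.minus] else []) ++ encNat z.natAbs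

/-- A preference: the list of the candidates from the top position to the bottom position. -/
def encPreference {m : ℕ} (p : Preference m) : List Letter :=
  (List.ofFn fun i => p.symm i).flatMap (fun c => encNat c) ++ [Letter.endBlock]

/-- The least common denominator of the entries of a rational vector. -/
def commonDen {m : ℕ} (α : Fin m → ℚ) : ℕ := Finset.univ.lcm fun i => (α i).den

/-- A rational vector, written over its least common denominator: the denominator, then the
numerators (the products below are integers), all in binary. -/
def encVector {m : ℕ} (α : Fin m → ℚ) : List Letter :=
  encNat (commonDen α) ++
    (List.ofFn fun i => (α i * commonDen α).num).flatMap encInt ++ [Letter.endBlock]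

/-- A set of voters: its characteristic vector. -/
def encVoters {n : ℕ} (M : Finset (Fin n)) : List Letter :=
  (List.ofFn fun v => Letter.bit (decide (v ∈ M))) ++ [Letter.endBlock]

/-- Scoring vector, tie-breaking order, and all votes. -/
def Election.encode (E : Election) : List Letter :=
  encVector E.α ++ encPreference E.tie ++
    (List.ofFn E.profile).flatMap encPreference ++ [Letter.endBlock]

/-- Encoding of CPMW instances. -/
def CPMW.encode (I : CPMW) : List Letter :=
  I.toElection.encode ++ encVoters I.M ++ encNat I.y

/-- Encoding of CPM instances. -/
def CPM.encode (I : CPM) : List Letter := I.toElection.encode ++ encVoters I.M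

/-- Encoding of CPMSW instances. -/
def CPMSW.encode (I : CPMSW) : List Letter :=
  I.toElection.encode ++ encNat I.y ++ encNat I.k

/-- Encoding of CPMS instances. -/
def CPMS.encode (I : CPMS) : List Letter := I.toElection.encode ++ encNat I.k

/-! ### Polynomial time -/

/-- The decision problem with instances `I`, encoded by `enc`, and yes-instances `Yes` is
decidable in polynomial time: some Turing machine, started on the encoding of any instance, halts
with the correct answer after a number of steps that is at most a fixed polynomial in the length
of the encoding. -/
def InP {I Γ : Type} (enc : I → List Γ) (Yes : I → Prop) : Prop :=
  ∃ f : I → Bool, (∀ a, f a = true ↔ Yes a) ∧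
    Nonempty (Turing.TM2ComputableInPolyTime enc Computability.encodeBool f)

end PossibleManipulators

/-!
Let `v` be the only suspect. Guess the current winner `x` and the positions `q < p` of `x` and `y`
in the changed vote of `v`; this fixes the new score of `y`. As the scoring vector is nonincreasing,
the positions at which another candidate stays behind `y` form an upward closed set, and for a
nested family of sets Hall's condition only has to be checked on initial segments of the positions.
So `y` can be made to win if and only if `x` stays behind `y` and a counting condition holds at each
position, and there are only polynomially many guesses.

Polynomial time is obtained from a calculus for functions of the input word and of numbers written
in unary: it is closed under recursion as long as the values stay polynomially bounded, and each of
its functions is computed by a register program, which is compiled to a Turing machine. Scores are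
exponentially large, so they are never computed: two sums of numbers given in binary are compared
digit by digit, with a carry that is bounded by twice the number of summands.
-/

namespace PossibleManipulators

section Voting

open Finset Function

/-! ### Winners -/

/-- A candidate `c` with score `σ` is preferred by the scoring rule to a candidate `d` with score
`τ`, where ties are broken according to `t`. -/
def Outranks {m : ℕ} (t : Preference m) (c d : Fin m) (σ τ : ℚ) : Prop :=
  (t d < t c → τ < σ) ∧ (t c ≤ t d → τ ≤ σ)

theorem Outranks.mono {m : ℕ} {t : Preference m} {c d : Fin m} {σ τ τ' : ℚ}
    (h : Outranks t c d σ τ) (hτ : τ' ≤ τ) : Outranks t c d σ τ' :=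
  ⟨fun hdc => hτ.trans_lt (h.1 hdc), fun hcd => hτ.trans (h.2 hcd)⟩

theorem tieBreak_eq_iff {m : ℕ} {t : Preference m} {S : Finset (Fin m)} {hS : S.Nonempty}
    {c : Fin m} : tieBreak t S hS = c ↔ c ∈ S ∧ ∀ d ∈ S, t c ≤ t d := by
  rw [tieBreak, Equiv.symm_apply_eq, Finset.min'_eq_iff]
  simp

theorem scoringRule_eq_iff {m n : ℕ} (hm : 0 < m) (α : Fin m → ℚ) (t : Preference m)
    (P : Profile m n) (c : Fin m) :
    scoringRule hm α t n P = c ↔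
      ∀ d, d ≠ c → Outranks t c d (score α P c) (score α P d) := by
  simp only [scoringRule, tieBreak_eq_iff, coWinners, mem_filter_univ]
  refine ⟨fun ⟨hmax, hfirst⟩ d _ => ⟨fun hdc => (hmax d).lt_of_not_ge fun hcd => ?_,
    fun _ => hmax d⟩, fun h => ?_⟩
  · exact hdc.not_ge (hfirst d fun e => (hmax e).trans hcd)
  · have hmax (d : Fin m) : score α P d ≤ score α P c := by
      rcases eq_or_ne d c with rfl | hd
      · exact le_rfl
      · exact (lt_or_ge (t d) (t c)).elim (fun hdc => ((h d hd).1 hdc).le) (h d hd).2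
    refine ⟨hmax, fun d hd => not_lt.1 fun hdc => ?_⟩
    exact (hd c).not_gt ((h d (ne_of_apply_ne t hdc.ne)).1 hdc)

/-! ### Placing the candidates -/

open Classical in
/-- By Hall's theorem: as the families are increasing, the union over a set `S` of positions is the
set at the maximum of `S`, so Hall's condition need only be checked on initial segments. -/
theorem exists_equiv_iff_card_le {A B : Type*} [Fintype A] [Fintype B] [LinearOrder B]
    (hAB : Fintype.card A = Fintype.card B) {ok : A → B → Prop} (hok : ∀ a, Monotone (ok a)) :
    (∃ e : A ≃ B, ∀ a, ok a (e a)) ↔ ∀ i, #{j : B | j ≤ i} ≤ #{a : A | ok a i} := by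
  constructor
  · rintro ⟨e, he⟩ i
    refine card_le_card_of_injOn e.symm (fun j hj => ?_) e.symm.injective.injOn
    have hj : j ≤ i := by simpa using hj
    simpa using hok (e.symm j) hj (by simpa using he (e.symm j))
  · intro h
    have hhall (S : Finset B) : #S ≤ #(S.biUnion fun i => {a : A | ok a i}) := by
      rcases S.eq_empty_or_nonempty with rfl | hS
      · simp
      calc #S ≤ #{j : B | j ≤ S.max' hS} :=
            card_le_card fun j hj => mem_filter_univ j |>.2 (S.le_max' j hj)
        _ ≤ #{a : A | ok a (S.max' hS)} := h _
        _ ≤ _ := card_le_card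
            (subset_biUnion_of_mem (fun i => ({a : A | ok a i} : Finset A)) (S.max'_mem hS))
    obtain ⟨f, hf, hfok⟩ := (all_card_le_biUnion_card_iff_exists_injective _).1 hhall
    let e := Equiv.ofBijective f ((Fintype.bijective_iff_injective_and_card f).2 ⟨hf, hAB.symm⟩)
    exact ⟨e.symm, fun a => by simpa [e, Equiv.ofBijective_apply_symm_apply] using hfok (e.symm a)⟩

open Classical in
theorem card_filter_subtype {β : Type*} [Fintype β] (P R : β → Prop) :
    #{b : {b // P b} | R b} = #{b : β | R b ∧ P b} := by
  rw [← card_map (Function.Embedding.subtype P)]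
  congr 1
  ext b
  simp [and_comm]

open Classical in
theorem exists_perm_apply_eq_and_iff {β : Type*} [Finite β] {x y p q : β} (hxy : x ≠ y)
    (hqp : q ≠ p) {ok : β → β → Prop} :
    (∃ Q : Equiv.Perm β, Q x = q ∧ Q y = p ∧ ∀ c, c ≠ x → c ≠ y → ok c (Q c)) ↔
      ∃ e : {c // c ≠ x ∧ c ≠ y} ≃ {j // j ≠ p ∧ j ≠ q},
        ∀ c : {c // c ≠ x ∧ c ≠ y}, ok c (e c) := by
  constructor
  · rintro ⟨Q, rfl, rfl, hQ⟩
    refine ⟨Q.subtypeEquiv fun c => ?_, fun c => hQ c c.2.1 c.2.2⟩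
    rw [Q.injective.ne_iff, Q.injective.ne_iff, and_comm]
  · rintro ⟨e, he⟩
    have hmem {c : β} (hc : ¬ (c ≠ x ∧ c ≠ y)) : e.extendSubtype c = p ∨ e.extendSubtype c = q := by
      simpa only [not_and_or, not_not] using e.extendSubtype_not_mem c hc
    have hx := hmem (c := x) (by simp)
    have hy := hmem (c := y) (by simp)
    have hne := e.extendSubtype.injective.ne hxy
    refine ⟨e.extendSubtype.trans (Equiv.swap (e.extendSubtype x) q), by simp, ?_,
      fun c hcx hcy => ?_⟩
    · rcases hx with hx | hx <;> rcases hy with hy | hy <;>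
        simp_all [hqp.symm]
    · have hc := e.extendSubtype_mem c ⟨hcx, hcy⟩
      rw [Equiv.trans_apply, Equiv.swap_apply_of_ne_of_ne (e.extendSubtype.injective.ne hcx) hc.2,
        e.extendSubtype_apply_of_mem c ⟨hcx, hcy⟩]
      exact he ⟨c, hcx, hcy⟩

open Classical in
theorem card_subtype_ne_and_ne {β : Type*} [Fintype β] {x y : β} (hxy : x ≠ y) :
    Fintype.card {c // c ≠ x ∧ c ≠ y} = Fintype.card β - 2 := by
  rw [Fintype.card_subtype, ← card_pair hxy, ← card_compl]
  congr 1
  ext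
  simp

open Classical in
theorem exists_perm_iff_card_le {β : Type*} [Fintype β] [LinearOrder β] {x y p q : β}
    (hxy : x ≠ y) (hqp : q ≠ p) {ok : β → β → Prop} (hok : ∀ c, Monotone (ok c)) :
    (∃ Q : Equiv.Perm β, Q x = q ∧ Q y = p ∧ ∀ c, c ≠ x → c ≠ y → ok c (Q c)) ↔
      ∀ i, i ≠ p → i ≠ q → #{j | j ≤ i ∧ j ≠ p ∧ j ≠ q} ≤ #{c | ok c i ∧ c ≠ x ∧ c ≠ y} := by
  have hcard : Fintype.card {c // c ≠ x ∧ c ≠ y} = Fintype.card {j // j ≠ p ∧ j ≠ q} := by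
    convert (card_subtype_ne_and_ne hxy).trans (card_subtype_ne_and_ne hqp.symm).symm
  have hpos (i : β) : #{j : {j // j ≠ p ∧ j ≠ q} | (j : β) ≤ i} = #{j | j ≤ i ∧ j ≠ p ∧ j ≠ q} := by
    convert card_filter_subtype (fun j => j ≠ p ∧ j ≠ q) (· ≤ i)
  have hcand (i : β) :
      #{c : {c // c ≠ x ∧ c ≠ y} | ok c i} = #{c | ok c i ∧ c ≠ x ∧ c ≠ y} := by
    convert card_filter_subtype (fun c => c ≠ x ∧ c ≠ y) (ok · i)
  rw [exists_perm_apply_eq_and_iff hxy hqp,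
    exists_equiv_iff_card_le hcard (ok := fun c i => ok c i) fun c _ _ hij => hok c hij]
  simp only [Subtype.forall, ← Subtype.coe_le_coe, and_imp, hpos, hcand]

/-! ### Changing a single vote -/

/-- The score of the candidate `c` after the vote `v` has been changed so that it places `c` at
position `i`; with `n ≤ v` there is no such vote, and nothing is changed. -/
def movedScore {m n : ℕ} (α : Fin m → ℚ) (P : Profile m n) (v : ℕ) (c i : Fin m) : ℚ :=
  ∑ w : Fin n, α (if (w : ℕ) = v then i else P w c)

section MovedScore

variable {m n : ℕ} {α : Fin m → ℚ}

theorem movedScore_of_le (P : Profile m n) {v : ℕ} (hv : n ≤ v) (c i : Fin m) :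
    movedScore α P v c i = score α P c :=
  sum_congr rfl fun w _ => by rw [if_neg (w.2.trans_le hv).ne]

theorem movedScore_apply (P : Profile m n) (v : Fin n) (Q : Preference m) (c : Fin m) :
    movedScore α P v c (Q c) = score α (update P v Q) c :=
  sum_congr rfl fun w _ => by
    simp only [Fin.val_inj, update_apply]
    split_ifs <;> rfl

theorem movedScore_antitone (hα : Antitone α) (P : Profile m n) (v : ℕ) (c : Fin m) :
    Antitone (movedScore α P v c) := fun i j hij =>
  sum_le_sum fun w _ => by
    split_ifs
    · exact hα hij
    · exact le_rfl

open Classical in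
theorem exists_vote_iff_card_le (hm : 0 < m) (hα : Antitone α) (t : Preference m)
    (P : Profile m n) (v : Fin n) {x y p q : Fin m} (hxy : x ≠ y) (hqp : q ≠ p) :
    (∃ Q : Preference m, Q x = q ∧ Q y = p ∧ scoringRule hm α t n (update P v Q) = y) ↔
      Outranks t y x (movedScore α P v y p) (movedScore α P v x q) ∧
        ∀ i, i ≠ p → i ≠ q → #{j | j ≤ i ∧ j ≠ p ∧ j ≠ q} ≤
          #{c | Outranks t y c (movedScore α P v y p) (movedScore α P v c i) ∧
            c ≠ x ∧ c ≠ y} := by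
  have hmono (c : Fin m) :
      Monotone fun i => Outranks t y c (movedScore α P v y p) (movedScore α P v c i) :=
    fun i j hij h => h.mono (movedScore_antitone hα P v c hij)
  rw [← exists_perm_iff_card_le hxy hqp hmono, ← exists_and_left]
  refine exists_congr fun Q => ?_
  simp only [scoringRule_eq_iff, ← movedScore_apply]
  constructor
  · rintro ⟨rfl, rfl, h⟩
    exact ⟨h x hxy, rfl, rfl, fun c _ hcy => h c hcy⟩
  · rintro ⟨hx, rfl, rfl, h⟩
    refine ⟨rfl, rfl, fun c hcy => ?_⟩
    rcases eq_or_ne c x with rfl | hcx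
    · exact hx
    · exact h c hcx hcy

end MovedScore

section Coalition

variable {m n : ℕ} (r : VotingRule m n) (P : Profile m n)

theorem replaceVotes_singleton (v : Fin n) (Q : ({v} : Finset (Fin n)) → Preference m) :
    replaceVotes P {v} Q = update P v (Q ⟨v, mem_singleton_self v⟩) := by
  funext w
  rcases eq_or_ne w v with rfl | hw <;> simp [replaceVotes, *]

theorem isCoalitionAgainst_singleton (v : Fin n) (y : Fin m) :
    IsCoalitionAgainst r P {v} y ↔
      y ≠ r P ∧ ∃ Q : Preference m, Q (r P) < Q y ∧ r (update P v Q) = y := by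
  simp only [IsCoalitionAgainst, replaceVotes_singleton, Preference.Prefers]
  refine and_congr_right fun hy => ⟨fun ⟨Q, hQ, hr⟩ => ?_, fun ⟨Q, hQ, hr⟩ =>
    ⟨fun _ => Q, fun _ => hQ.le, hr⟩⟩
  exact ⟨_, (hQ ⟨v, mem_singleton_self v⟩).lt_of_ne ((Equiv.injective _).ne hy.symm), hr⟩

theorem not_isCoalitionAgainst_empty (y : Fin m) : ¬ IsCoalitionAgainst r P ∅ y := by
  rintro ⟨hy, Q, -, hr⟩
  have hP : replaceVotes P ∅ Q = P := funext fun v => dif_neg (notMem_empty v)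
  exact hy (hP ▸ hr).symm

end Coalition

end Voting

section Machines

open Function Turing StateTransition

variable {A : Type}

/-! ### Register programs -/

/-- Structured programs over registers holding natural numbers, with a read head on a fixed word:
the high-level machine model that is compiled to Turing machines. `test q r` increments `r` if the
letter under the head satisfies `q`; `loop r p` executes `p` as long as `r` is nonzero,
decrementing `r` before each execution. -/
inductive Prog (A : Type) : Type
  | skip
  | inc (r : ℕ)
  | right
  | left
  | test (q : A → Bool) (r : ℕ)
  | seq (p₁ p₂ : Prog A)
  | loop (r : ℕ) (p : Prog A)

/-- `Runs s p S h S' h' t`: on the word `s`, the program `p` started with registers `S` and head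
position `h` ends with registers `S'` and head position `h'` after at most `t` steps. The position
`s.length`, where no letter is under the head, is allowed. -/
inductive Runs (s : List A) : Prog A → (ℕ → ℕ) → ℕ → (ℕ → ℕ) → ℕ → ℕ → Prop
  | skip {S h} : Runs s .skip S h S h 1
  | inc {S h r} : Runs s (.inc r) S h (update S r (S r + 1)) h 1
  | right {S h} : Runs s .right S h S (if h < s.length then h + 1 else h) 1
  | left {S h} : Runs s .left S h S (h - 1) 1
  | test {S h q r} :
      Runs s (.test q r) S h (if s[h]?.any q then update S r (S r + 1) else S) h 1
  | seq {p₁ p₂ S h S₁ h₁ S₂ h₂ t₁ t₂} : Runs s p₁ S h S₁ h₁ t₁ → Runs s p₂ S₁ h₁ S₂ h₂ t₂ →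
      Runs s (.seq p₁ p₂) S h S₂ h₂ (t₁ + t₂)
  | loop_zero {S h r p} : S r = 0 → Runs s (.loop r p) S h S h 1
  | loop_succ {S h r p n S₁ h₁ S₂ h₂ t₁ t₂} : S r = n + 1 →
      Runs s p (update S r n) h S₁ h₁ t₁ → Runs s (.loop r p) S₁ h₁ S₂ h₂ t₂ →
      Runs s (.loop r p) S h S₂ h₂ (1 + t₁ + t₂)
  | mono {p S h S' h' t t'} : Runs s p S h S' h' t → t ≤ t' → Runs s p S h S' h' t'

theorem Runs.head_le {s : List A} {p : Prog A} {S S' : ℕ → ℕ} {h h' t : ℕ}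
    (hr : Runs s p S h S' h' t) (hh : h ≤ s.length) : h' ≤ s.length := by
  induction hr with
  | skip | inc | test | loop_zero => exact hh
  | right => split_ifs <;> omega
  | left => omega
  | seq _ _ ih₁ ih₂ | loop_succ _ _ _ ih₁ ih₂ => exact ih₂ (ih₁ hh)
  | mono _ _ ih => exact ih hh

/-- A strict upper bound on the registers that occur in a program. -/
def Prog.width : Prog A → ℕ
  | .inc r | .test _ r => r + 1
  | .seq p₁ p₂ => max p₁.width p₂.width
  | .loop r p => max (r + 1) p.width
  | _ => 0

/-! ### Compilation to stack machines -/

/-- The stacks of the compiled machine: unary registers, the two halves of the input word around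
the head, and the output. -/
inductive Stk (N : ℕ) : Type
  | reg (i : Fin N)
  | before
  | after
  | out
  deriving DecidableEq, Fintype

/-- The alphabets of the stacks. -/
abbrev StkAlphabet (A : Type) (N : ℕ) : Stk N → Type
  | .reg _ => Unit
  | .before | .after => A
  | .out => Bool

/-- Stack contents in which the registers hold `S`. -/
def contents (N : ℕ) (S : ℕ → ℕ) (before after : List A) (out : List Bool) :
    (k : Stk N) → List (StkAlphabet A N k)
  | .reg i => List.replicate (S i) ()
  | .before => before
  | .after => after
  | .out => out

section contents

variable {N : ℕ} {S : ℕ → ℕ} {a b : List A} {o : List Bool}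

@[simp]
theorem contents_before : contents N S a b o .before = a := rfl

@[simp]
theorem contents_after : contents N S a b o .after = b := rfl

@[simp]
theorem contents_out : contents N S a b o .out = o := rfl

@[simp]
theorem update_contents_before (a' : List A) :
    update (contents N S a b o) .before a' = contents N S a' b o := by
  funext k; cases k <;> simp [update, contents]

@[simp]
theorem update_contents_after (b' : List A) :
    update (contents N S a b o) .after b' = contents N S a b' o := by
  funext k; cases k <;> simp [update, contents]

@[simp]
theorem update_contents_out (o' : List Bool) :
    update (contents N S a b o) .out o' = contents N S a b o' := by
  funext k; cases k <;> simp [update, contents]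

variable [NeZero N] {r : ℕ}

theorem contents_reg (hr : r < N) :
    contents N S a b o (.reg (Fin.ofNat N r)) = List.replicate (S r) () := by
  simp [contents, Nat.mod_eq_of_lt hr]

theorem update_contents_reg (hr : r < N) (n : ℕ) :
    update (contents N S a b o) (.reg (Fin.ofNat N r)) (List.replicate n ()) =
      contents N (update S r n) a b o := by
  funext k
  rcases k with i | _ | _ | _
  · obtain rfl | hi := eq_or_ne i (Fin.ofNat N r)
    · rw [update_self, contents_reg hr, update_self]
    · have hir : (i : ℕ) ≠ r := fun h => hi (Fin.ext (by simp [h, Nat.mod_eq_of_lt hr]))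
      rw [update_of_ne (by simpa using hi)]
      simp [contents, hir]
  all_goals simp [contents]

end contents

/-- The label type of the compiled program. -/
def Prog.Label : Prog A → Type
  | .seq p₁ p₂ => p₁.Label ⊕ p₂.Label
  | .loop _ p => Option p.Label
  | _ => Unit

/-- The label at which the compiled program starts. -/
def Prog.entry : (p : Prog A) → p.Label
  | .seq p₁ _ => Sum.inl p₁.entry
  | .loop _ _ => none
  | .skip | .inc _ | .right | .left | .test _ _ => ()

instance Prog.instFintypeLabel : (p : Prog A) → Fintype p.Label
  | .seq p₁ p₂ => @instFintypeSum _ _ p₁.instFintypeLabel p₂.instFintypeLabel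
  | .loop _ p => @instFintypeOption _ p.instFintypeLabel
  | .skip | .inc _ | .right | .left | .test _ _ => inferInstanceAs (Fintype Unit)

/-- The statements of the compiled machine. Its internal state consists of the letter read last
and a flag. -/
abbrev MStmt (A : Type) (N : ℕ) (L : Type) : Type :=
  TM2.Stmt (StkAlphabet A N) L (Option A × Bool)

/-- The configurations of the compiled machine between two instructions of the program. -/
abbrev cfg {N : ℕ} {L : Type} (l : Option L) (stk : (k : Stk N) → List (StkAlphabet A N k)) :
    TM2.Cfg (StkAlphabet A N) L (Option A × Bool) :=
  ⟨l, (none, false), stk⟩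

section code

open TM2.Stmt

variable {N : ℕ} {L : Type}

/-- Reset the internal state and continue at the label `l`. -/
def resetGoto (l : L) : MStmt A N L :=
  load (fun _ => (none, false)) (goto fun _ => l)

variable [NeZero N]

/-- Increment the register `r`. -/
def pushReg (r : ℕ) (q : MStmt A N L) : MStmt A N L :=
  push (.reg (Fin.ofNat N r)) (fun _ => ()) q

/-- Decrement the register `r` and record in the flag whether it was nonzero. -/
def popReg (r : ℕ) (q : MStmt A N L) : MStmt A N L :=
  pop (.reg (Fin.ofNat N r)) (fun _ (o : Option Unit) => (none, o.isSome)) q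

/-- The code of a program whose labels are embedded in `L` by `emb`; it continues at `exit`. -/
def Prog.code [Inhabited A] (N : ℕ) [NeZero N] :
    (p : Prog A) → (emb : p.Label → L) → (exit : L) → p.Label → MStmt A N L
  | .skip, _, exit, _ => resetGoto exit
  | .inc r, _, exit, _ => pushReg r (resetGoto exit)
  | .right, _, exit, _ =>
      pop .after (fun _ (o : Option A) => (o, false))
        (branch (fun v => v.1.isSome)
          (push .before (fun v => (v.1.getD default : A)) (resetGoto exit))
          (resetGoto exit))
  | .left, _, exit, _ =>
      pop .before (fun _ (o : Option A) => (o, false))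
        (branch (fun v => v.1.isSome)
          (push .after (fun v => (v.1.getD default : A)) (resetGoto exit))
          (resetGoto exit))
  | .test q r, _, exit, _ =>
      peek .after (fun _ (o : Option A) => (o, false))
        (branch (fun v => v.1.any q) (pushReg r (resetGoto exit)) (resetGoto exit))
  | .seq p₁ p₂, emb, _, Sum.inl l => p₁.code N (emb ∘ Sum.inl) (emb (Sum.inr p₂.entry)) l
  | .seq _ p₂, emb, exit, Sum.inr l => p₂.code N (emb ∘ Sum.inr) exit l
  | .loop r p, emb, exit, none =>
      popReg r (branch (fun v => v.2) (resetGoto (emb (some p.entry))) (resetGoto exit))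
  | .loop _ p, emb, _, some l => p.code N (emb ∘ some) (emb none) l

end code

section stepAux

variable {N : ℕ} {L : Type} {S : ℕ → ℕ} {a b : List A} {o : List Bool} {v : Option A × Bool}

@[simp]
theorem stepAux_resetGoto {stk : (k : Stk N) → List (StkAlphabet A N k)} (l : L) :
    TM2.stepAux (resetGoto l) v stk = cfg (some l) stk := rfl

variable [NeZero N] {r : ℕ}

theorem stepAux_pushReg (hr : r < N) (q : MStmt A N L) :
    TM2.stepAux (pushReg r q) v (contents N S a b o) =
      TM2.stepAux q v (contents N (update S r (S r + 1)) a b o) := by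
  rw [← update_contents_reg hr, List.replicate_succ, ← contents_reg hr]
  rfl

theorem stepAux_popReg (hr : r < N) (q : MStmt A N L) :
    TM2.stepAux (popReg r q) v (contents N S a b o) =
      TM2.stepAux q (none, decide (S r ≠ 0)) (contents N (update S r (S r - 1)) a b o) := by
  rw [← update_contents_reg hr, popReg, TM2.stepAux, contents_reg hr]
  cases S r <;> rfl

end stepAux

/-! ### Correctness of the compilation -/

/-- The configuration `c'` is reached from `c` in at most `t` steps of `f`. -/
def ReachesIn {C : Type} (f : C → Option C) (c c' : C) (t : ℕ) : Prop :=
  Nonempty (EvalsToInTime f c (some c') t)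

section ReachesIn

variable {C : Type} {f : C → Option C} {a b c : C} {t t₁ t₂ : ℕ}

theorem ReachesIn.trans (h₁ : ReachesIn f a b t₁) (h₂ : ReachesIn f b c t₂) :
    ReachesIn f a c (t₁ + t₂) := by
  obtain ⟨⟨h₁⟩, ⟨h₂⟩⟩ := And.intro h₁ h₂
  exact add_comm t₂ t₁ ▸ ⟨h₁.trans f t₁ t₂ a b (some c) h₂⟩

theorem ReachesIn.single (h : f a = some b) : ReachesIn f a b 1 :=
  ⟨⟨⟨1, h⟩, le_rfl⟩⟩

theorem ReachesIn.mono (h : ReachesIn f a b t₁) (ht : t₁ ≤ t₂) : ReachesIn f a b t₂ :=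
  h.map fun h => ⟨h.toEvalsTo, h.steps_le_m.trans ht⟩

end ReachesIn

section simulation

variable {N : ℕ} {L : Type} {M : L → MStmt A N L} {s : List A} {S : ℕ → ℕ} {h r : ℕ}

/-- The stacks that represent the registers `S` and the head position `h` on the word `s`. -/
abbrev contentsAt (N : ℕ) (s : List A) (S : ℕ → ℕ) (h : ℕ) :
    (k : Stk N) → List (StkAlphabet A N k) :=
  contents N S (s.take h).reverse (s.drop h) []

theorem contentsAt_of_lt (hh : h < s.length) :
    contentsAt N s S h = contents N S (s.take h).reverse (s[h] :: s.drop (h + 1)) [] := by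
  rw [contentsAt, List.drop_eq_getElem_cons hh]

theorem contentsAt_succ (hh : h < s.length) :
    contentsAt N s S (h + 1) = contents N S (s[h] :: (s.take h).reverse) (s.drop (h + 1)) [] := by
  rw [contentsAt, List.take_succ_eq_append_getElem hh, List.reverse_append]
  rfl

theorem reachesIn_one {l : L} {c : TM2.Cfg (StkAlphabet A N) L (Option A × Bool)}
    {stk : (k : Stk N) → List (StkAlphabet A N k)} (h : TM2.stepAux (M l) (none, false) stk = c) :
    ReachesIn (TM2.step M) (cfg (some l) stk) c 1 :=
  ReachesIn.single (congrArg some h)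

variable [Inhabited A] [NeZero N] {exit l : L}

theorem stepAux_code_right (emb : Unit → L) :
    TM2.stepAux (Prog.right.code N emb exit ()) (none, false) (contentsAt N s S h) =
      cfg (some exit) (contentsAt N s S (if h < s.length then h + 1 else h)) := by
  split_ifs with hh
  · rw [contentsAt_of_lt hh, contentsAt_succ hh]
    simp [Prog.code, TM2.stepAux, hh]
  · simp [Prog.code, TM2.stepAux, contentsAt, List.drop_eq_nil_of_le (not_lt.1 hh)]

theorem stepAux_code_left (hh : h ≤ s.length) (emb : Unit → L) :
    TM2.stepAux (Prog.left.code N emb exit ()) (none, false) (contentsAt N s S h) =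
      cfg (some exit) (contentsAt N s S (h - 1)) := by
  cases h with
  | zero => simp [Prog.code, TM2.stepAux, contentsAt]
  | succ h =>
    rw [contentsAt_succ hh, Nat.add_sub_cancel, contentsAt_of_lt hh]
    simp [Prog.code, TM2.stepAux]

theorem stepAux_code_test (hr : r < N) (q : A → Bool) (emb : Unit → L) :
    TM2.stepAux ((Prog.test q r).code N emb exit ()) (none, false) (contentsAt N s S h) =
      cfg (some exit) (contentsAt N s (if s[h]?.any q then update S r (S r + 1) else S) h) := by
  simp only [Prog.code, TM2.stepAux, contents_after, List.head?_drop, stepAux_pushReg hr]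
  cases s[h]?.any q <;> rfl

theorem stepAux_code_loop (hr : r < N) (p : Prog A) (emb : Option p.Label → L) :
    TM2.stepAux ((Prog.loop r p).code N emb exit none) (none, false) (contentsAt N s S h) =
      cfg (some (if S r = 0 then exit else emb (some p.entry)))
        (contentsAt N s (update S r (S r - 1)) h) := by
  simp only [Prog.code, stepAux_popReg hr]
  by_cases h0 : S r = 0 <;> simp [TM2.stepAux, h0]

theorem Runs.reachesIn {p : Prog A} {S' : ℕ → ℕ} {h' t : ℕ} (hr : Runs s p S h S' h' t)
    (hh : h ≤ s.length) (hN : p.width ≤ N) (emb : p.Label → L)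
    (hM : ∀ l, M (emb l) = p.code N emb exit l) :
    ReachesIn (TM2.step M) (cfg (some (emb p.entry)) (contentsAt N s S h))
      (cfg (some exit) (contentsAt N s S' h')) t := by
  induction hr generalizing exit with
  | mono _ ht ih => exact (ih hh hN emb hM).mono ht
  | skip => exact reachesIn_one (hM () ▸ rfl)
  | inc => exact reachesIn_one (hM () ▸ stepAux_pushReg hN _)
  | right => exact reachesIn_one (hM () ▸ stepAux_code_right emb)
  | left => exact reachesIn_one (hM () ▸ stepAux_code_left hh emb)
  | test => exact reachesIn_one (hM () ▸ stepAux_code_test hN _ emb)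
  | seq hr₁ _ ih₁ ih₂ =>
    exact (ih₁ hh (le_of_max_le_left hN) _ fun l => hM (Sum.inl l)).trans
      (ih₂ (hr₁.head_le hh) (le_of_max_le_right hN) _ fun l => hM (Sum.inr l))
  | loop_zero h0 =>
    refine reachesIn_one (hM none ▸ (stepAux_code_loop (le_of_max_le_left hN) _ emb).trans ?_)
    rw [if_pos h0, h0, Nat.zero_sub, update_eq_self_iff.2 h0.symm]
  | loop_succ h0 hr₁ _ ih₁ ih₂ =>
    refine ((reachesIn_one ?_).trans (ih₁ hh (le_of_max_le_right hN) (emb ∘ some)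
      fun l => hM (some l))).trans (ih₂ (hr₁.head_le hh) hN emb hM)
    refine hM none ▸ (stepAux_code_loop (le_of_max_le_left hN) _ emb).trans ?_
    rw [if_neg (by omega), h0]
    rfl

end simulation

/-! ### Deciding by means of a program -/

/-- The two phases of a decider that follow the execution of its program. -/
inductive Phase
  | answer
  | erase
  deriving DecidableEq

instance : Fintype Phase :=
  ⟨{.answer, .erase}, by rintro ⟨⟩ <;> decide⟩

section decider

open TM2.Stmt

variable [Inhabited A]

/-- The code of the machine that decides by means of `p`: it executes `p`, answers whether register
`0` is nonzero, and erases the input. -/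
def deciderCode (N : ℕ) [NeZero N] (p : Prog A) : p.Label ⊕ Phase → MStmt A N (p.Label ⊕ Phase)
  | Sum.inl l => p.code N Sum.inl (Sum.inr .answer) l
  | Sum.inr .answer => popReg 0 (push .out (fun v => v.2) (resetGoto (Sum.inr .erase)))
  | Sum.inr .erase =>
      pop .after (fun _ (o : Option A) => (o, false))
        (branch (fun v => v.1.isSome) (resetGoto (Sum.inr .erase))
          (load (fun _ => (none, false)) halt))

/-- The machine that decides by means of the program `p`. -/
def decider [Fintype A] (N : ℕ) [NeZero N] (p : Prog A) : FinTM2 where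
  K := Stk N
  k₀ := .after
  k₁ := .out
  Γ := StkAlphabet A N
  Λ := p.Label ⊕ Phase
  main := Sum.inl p.entry
  σ := Option A × Bool
  initialState := (none, false)
  Γk₀Fin := inferInstanceAs (Fintype A)
  m := deciderCode N p

variable {N : ℕ} [NeZero N] {p : Prog A} {S : ℕ → ℕ} {b : Bool}

theorem reachesIn_erase (s : List A) :
    ReachesIn (TM2.step (deciderCode N p)) (cfg (some (Sum.inr .erase)) (contents N S [] s [b]))
      (cfg none (contents N S [] [] [b])) (s.length + 1) := by
  induction s with
  | nil => exact reachesIn_one (by simp [deciderCode, TM2.stepAux])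
  | cons x s ih =>
    rw [List.length_cons, add_comm]
    exact (reachesIn_one (by simp [deciderCode, TM2.stepAux])).trans ih

theorem Runs.reachesIn_decider (hN : p.width ≤ N) {s : List A} {t : ℕ}
    (hr : Runs s p 0 0 (update 0 0 b.toNat) 0 t) :
    ReachesIn (TM2.step (deciderCode N p)) (cfg (some (Sum.inl p.entry)) (contents N 0 [] s []))
      (cfg none (contents N 0 [] [] [b])) (t + 1 + (s.length + 1)) := by
  refine ((hr.reachesIn (exit := Sum.inr .answer) (Nat.zero_le _) hN Sum.inl fun _ => rfl).trans
    (reachesIn_one ?_)).trans (reachesIn_erase s)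
  rw [deciderCode, stepAux_popReg (Nat.pos_of_neZero N)]
  cases b <;> simp [TM2.stepAux]

variable [Fintype A]

theorem initList_decider (s : List A) :
    initList (decider N p) s = cfg (some (Sum.inl p.entry)) (contents N 0 [] s []) := by
  unfold initList
  congr 1
  funext k
  cases k with
  | after => exact dif_pos rfl
  | _ => exact dif_neg (by simp [decider])

theorem haltList_decider (o : List Bool) :
    haltList (decider N p) o = cfg none (contents N 0 [] [] o) := by
  unfold haltList
  congr 1
  funext k
  cases k with
  | out => exact dif_pos rfl
  | _ => exact dif_neg (by simp [decider])

end decider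

theorem inP_of_runs [Finite A] [Inhabited A] {I : Type} {enc : I → List A} {Yes : I → Prop}
    (f : I → Bool) (hf : ∀ a, f a = true ↔ Yes a) (p : Prog A) (T : Polynomial ℕ)
    (hp : ∀ a, Runs (enc a) p 0 0 (update 0 0 (f a).toNat) 0 (T.eval (enc a).length)) :
    InP enc Yes := by
  have := Fintype.ofFinite A
  refine ⟨f, hf, ⟨{
    tm := decider (p.width + 1) p
    inputAlphabet := Equiv.refl A
    outputAlphabet := Equiv.refl Bool
    time := T + 1 + (Polynomial.X + 1)
    outputsFun := fun a => Classical.choice ?_ }⟩⟩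
  have hinit : initList (decider (p.width + 1) p) ((enc a).map (Equiv.refl A).invFun) = _ :=
    (congrArg (initList (decider _ p)) (List.map_id _)).trans (initList_decider (enc a))
  have hhalt : haltList (decider (p.width + 1) p)
      ((Computability.encodeBool (f a)).map (Equiv.refl Bool).invFun) = _ :=
    (congrArg (haltList (decider _ p)) (List.map_id _)).trans (haltList_decider [f a])
  rw [Polynomial.eval_add, Polynomial.eval_add, Polynomial.eval_add, Polynomial.eval_X,
    Polynomial.eval_one]
  exact (congrArg₂ (fun c c' => ReachesIn (decider _ p).step c c' _) hinit hhalt).mpr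
    ((hp a).reachesIn_decider (Nat.le_succ p.width))

end Machines

section PolynomialTime

open Function

variable {A : Type}

/-! ### Running times of some programs -/

section Runs

variable {s : List A} {S S' S'' : ℕ → ℕ} {h h' h'' t t' : ℕ}

theorem Runs.congr {p : Prog A} (hr : Runs s p S h S' h' t) (hS : S' = S'') (hh : h' = h'')
    (ht : t ≤ t') : Runs s p S h S'' h'' t' :=
  hS ▸ hh ▸ hr.mono ht

theorem Runs.loop {p : Prog A} {r n : ℕ} {σ : ℕ → ℕ → ℕ} {H : ℕ → ℕ} (hS : S = σ 0)
    (hh : h = H 0) (hpos : ∀ i < n, σ i r ≠ 0) (hzero : σ n r = 0)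
    (hstep : ∀ i < n, Runs s p (update (σ i) r (σ i r - 1)) (H i) (σ (i + 1)) (H (i + 1)) t) :
    Runs s (.loop r p) S h (σ n) (H n) (n * (t + 1) + 1) := by
  subst hS hh
  induction n generalizing σ H with
  | zero => exact (Runs.loop_zero hzero).mono (by omega)
  | succ n ih =>
    have htail := @ih (fun i => σ (i + 1)) (fun i => H (i + 1)) (fun i hi => hpos _ (by omega))
      hzero fun i hi => hstep _ (by omega)
    exact (Runs.loop_succ (Nat.succ_pred_eq_of_ne_zero (hpos 0 n.succ_pos)).symm
      (hstep 0 n.succ_pos) htail).mono (by linarith)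

/-- Set the register `r` to zero. -/
def Prog.clear (r : ℕ) : Prog A := .loop r .skip

theorem Runs.clear {r : ℕ} : Runs s (.clear r) S h (update S r 0) h (S r * 2 + 1) :=
  (Runs.loop (n := S r) (σ := fun i => update S r (S r - i)) (H := fun _ => h) (by simp) rfl
    (fun i hi => by simp; omega) (by simp) fun i _ =>
      Runs.skip.congr (by grind [update_apply]) rfl le_rfl).congr (by simp) rfl le_rfl

/-- Add the register `r` to the register `o` and set `r` to zero. -/
def Prog.move (r o : ℕ) : Prog A := .loop r (.inc o)

theorem Runs.move {r o : ℕ} (hro : r ≠ o) :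
    Runs s (.move r o) S h (update (update S r 0) o (S o + S r)) h (S r * 2 + 1) :=
  (Runs.loop (n := S r) (σ := fun i => update (update S r (S r - i)) o (S o + i))
    (H := fun _ => h) (by simp) rfl (fun i hi => by grind [update_apply])
    (by grind [update_apply]) fun i _ => Runs.inc.congr (by grind [update_apply]) rfl le_rfl).congr
    (by simp) rfl le_rfl

/-- Add the register `r` to the register `o`, by means of the scratch register `c`. -/
def Prog.copy (r c o : ℕ) : Prog A := .seq (.loop r (.seq (.inc c) (.inc o))) (.move c r)

theorem Runs.copy {r c o : ℕ} (hrc : r ≠ c) (hro : r ≠ o) (hco : c ≠ o) (hc : S c = 0) :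
    Runs s (.copy r c o) S h (update S o (S o + S r)) h (S r * 5 + 2) := by
  have hloop : Runs s (.loop r (.seq (.inc c) (.inc o))) S h
      (update (update (update S r 0) c (S r)) o (S o + S r)) h (S r * 3 + 1) :=
    (Runs.loop (n := S r)
      (σ := fun i => update (update (update S r (S r - i)) c i) o (S o + i))
      (H := fun _ => h) (by grind [update_apply]) rfl (fun i hi => by grind [update_apply])
      (by grind [update_apply]) fun i _ =>
        (Runs.inc.seq Runs.inc).congr (by grind [update_apply]) rfl le_rfl).congr
      (by grind [update_apply]) rfl le_rfl
  exact (hloop.seq (Runs.move hrc.symm)).congr (by grind [update_apply]) rfl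
    (by grind [update_apply])

/-- Move the head to the right as often as `r` says, and move `r` to `c`. -/
def Prog.seek (r c : ℕ) : Prog A := .loop r (.seq .right (.inc c))

theorem Runs.seek {r c : ℕ} (hrc : r ≠ c) (hc : S c = 0) :
    Runs s (.seek r c) S 0 (update (update S r 0) c (S r)) (min (S r) s.length) (S r * 3 + 1) :=
  (Runs.loop (n := S r) (σ := fun i => update (update S r (S r - i)) c i)
    (H := fun i => min i s.length) (by grind [update_apply]) (by simp)
    (fun i hi => by grind [update_apply]) (by grind [update_apply]) fun i _ =>
      (Runs.right.seq Runs.inc).congr (by grind [update_apply]) (by grind) le_rfl).congr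
    (by simp) rfl le_rfl

/-- Move the head to the left as often as `r` says. -/
def Prog.rewind (r : ℕ) : Prog A := .loop r .left

theorem Runs.rewind {r : ℕ} : Runs s (.rewind r) S h (update S r 0) (h - S r) (S r * 2 + 1) :=
  (Runs.loop (n := S r) (σ := fun i => update S r (S r - i)) (H := fun i => h - i) (by simp)
    (by simp) (fun i hi => by simp; omega) (by simp) fun i _ =>
      Runs.left.congr (by grind [update_apply]) (by omega) le_rfl).congr (by simp) rfl le_rfl

/-- Increment the register `r` if the head is not beyond the end of the word. -/
def Prog.incInside (r : ℕ) : Prog A := .test (fun _ => true) r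

theorem Runs.incInside {r : ℕ} :
    Runs s (.incInside r) S h (update S r (S r + if h < s.length then 1 else 0)) h 1 := by
  refine Runs.test.congr ?_ rfl le_rfl
  by_cases hh : h < s.length <;> simp [hh]

/-- Move the head to the end of the word and count the letters in `c` and in `o`. The loop is
controlled by the flag `b`, which each round sets as long as there is a letter. -/
def Prog.scan (b c o : ℕ) : Prog A :=
  .loop b (.seq (.seq (.incInside b) (.incInside c)) (.seq (.incInside o) .right))

theorem Runs.scan {b c o : ℕ} (hbc : b ≠ c) (hbo : b ≠ o) (hco : c ≠ o) (hb : S b = 1)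
    (hc : S c = 0) (ho : S o = 0) :
    Runs s (.scan b c o) S 0 (update (update (update S b 0) c s.length) o s.length) s.length
      ((s.length + 1) * 5 + 1) :=
  (Runs.loop (n := s.length + 1)
    (σ := fun i => update (update (update S b (if i ≤ s.length then 1 else 0)) c
      (min i s.length)) o (min i s.length))
    (H := fun i => min i s.length) (by grind [update_apply]) (by simp)
    (fun i hi => by grind [update_apply]) (by grind [update_apply]) fun i _ =>
      ((Runs.incInside.seq Runs.incInside).seq (Runs.incInside.seq Runs.right)).congr
        (by grind [update_apply]) (by grind) le_rfl).congr
    (by simp) (by simp) le_rfl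

/-- Execute `p` as often as the register `b` says. Here `p` computes the next value of the register
`o` from the register `o` and the number of the round, which is in the register `b + 1`; it writes
the result to the register `b + 2`. -/
def Prog.iterate (p : Prog A) (o b : ℕ) : Prog A :=
  .seq (.loop b (.seq (.seq p (.clear o)) (.seq (.move (b + 2) o) (.inc (b + 1)))))
    (.clear (b + 1))

theorem Runs.iterate {p : Prog A} {o b n q : ℕ} {f : ℕ → ℕ} (hob : o < b) (hb : S b = n)
    (hb₁ : S (b + 1) = 0) (hb₂ : S (b + 2) = 0) (ho : S o = f 0) (hq : ∀ i ≤ n, f i ≤ q)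
    (hp : ∀ i < n, ∀ c,
      Runs s p (update (update (update S b c) (b + 1) i) o (f i)) 0
        (update (update (update (update S b c) (b + 1) i) o (f i)) (b + 2) (f (i + 1))) 0 t) :
    Runs s (.iterate p o b) S 0 (update (update S b 0) o (f n)) 0
      (n * (t + q * 4 + 4) + n * 2 + 2) := by
  have hround : ∀ i < n, ∀ c,
      Runs s (.seq (.seq p (.clear o)) (.seq (.move (b + 2) o) (.inc (b + 1))))
        (update (update (update S b c) (b + 1) i) o (f i)) 0
        (update (update (update S b c) (b + 1) (i + 1)) o (f (i + 1))) 0 (t + q * 4 + 3) := by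
    intro i hi c
    have hfi := hq i hi.le
    have hfi' := hq (i + 1) hi
    exact (((hp i hi c).seq Runs.clear).seq ((Runs.move (by omega)).seq Runs.inc)).congr
      (by grind [update_apply]) rfl (by grind [update_apply])
  have hloop := Runs.loop (n := n) (r := b) (S := S) (h := 0)
    (σ := fun i => update (update (update S b (n - i)) (b + 1) i) o (f i)) (H := fun _ => 0)
    (by grind [update_apply]) rfl (fun i hi => by grind [update_apply])
    (by grind [update_apply]) fun i hi => by
      convert hround i hi (n - (i + 1)) using 1
      grind [update_apply]
  exact (hloop.seq Runs.clear).congr (by grind [update_apply]) rfl (by grind [update_apply])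

end Runs

/-! ### Functions of a word and unary numbers that are computable in polynomial time -/

/-- The elements of `α` consist of a word `str` over `A` and of natural numbers `var i`,
`i < arity`: the possible domains of the functions that are computed by programs. -/
class Context (A : outParam Type) (α : Type) where
  str : α → List A
  arity : ℕ
  var : α → ℕ → ℕ

instance : Context A (List A) where
  str s := s
  arity := 0
  var _ _ := 0

instance {α : Type} [Context A α] : Context A (α × ℕ) where
  str a := Context.str a.1
  arity := Context.arity α + 1
  var a i := if i = Context.arity α then a.2 else Context.var a.1 i

open Context

variable {α : Type} [Context A α]

/-- The size of a context, in which all numbers count in unary. -/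
def Context.size (a : α) : ℕ := (str a).length + ∑ i ∈ Finset.range (arity α), var a i

theorem Context.length_str_le_size (a : α) : (str a).length ≤ size a := Nat.le_add_right _ _

theorem Context.size_prod (a : α) (n : ℕ) : size (a, n) = size a + n := by
  have hvar : ∀ i ∈ Finset.range (arity α), var (a, n) i = var a i := fun i hi =>
    if_neg (Finset.mem_range.1 hi).ne
  change (str a).length + ∑ i ∈ Finset.range (arity α + 1), var (a, n) i = _
  rw [Finset.sum_range_succ, Finset.sum_congr rfl hvar, ← add_assoc]
  exact congrArg _ (if_pos rfl)

/-- The registers `S` hold the numbers of the context `a` at the locations `loc`. The output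
register `o` and the scratch registers, which start at `b`, are zero. -/
structure Holds (loc : ℕ → ℕ) (o b : ℕ) (a : α) (S : ℕ → ℕ) : Prop where
  loc_lt : ∀ i < arity α, loc i < b
  loc_ne : ∀ i < arity α, loc i ≠ o
  out_lt : o < b
  var : ∀ i < arity α, S (loc i) = var a i
  out : S o = 0
  scratch : ∀ r, b ≤ r → S r = 0

section Holds

variable {loc : ℕ → ℕ} {o b : ℕ} {a : α} {S : ℕ → ℕ}

theorem Holds.out_scratch (h : Holds loc o b a S) : Holds loc b (b + 1) a S where
  loc_lt i hi := (h.loc_lt i hi).trans b.lt_succ_self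
  loc_ne i hi := (h.loc_lt i hi).ne
  out_lt := b.lt_succ_self
  var := h.var
  out := h.scratch b le_rfl
  scratch r hr := h.scratch r (by omega)

theorem Holds.update_scratch (h : Holds loc o b a S) (x : ℕ) :
    Holds loc o (b + 1) a (update S b x) where
  loc_lt i hi := (h.loc_lt i hi).trans b.lt_succ_self
  loc_ne := h.loc_ne
  out_lt := h.out_lt.trans b.lt_succ_self
  var i hi := by rw [update_of_ne (h.loc_lt i hi).ne, h.var i hi]
  out := by rw [update_of_ne h.out_lt.ne, h.out]
  scratch r hr := by rw [update_of_ne (by omega), h.scratch r (by omega)]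

theorem Holds.fst {a : α × ℕ} (h : Holds loc o b a S) : Holds loc o b a.1 S where
  loc_lt i hi := h.loc_lt i (hi.trans (Nat.lt_succ_self _))
  loc_ne i hi := h.loc_ne i (hi.trans (Nat.lt_succ_self _))
  out_lt := h.out_lt
  var i hi := (h.var i (hi.trans (Nat.lt_succ_self _))).trans (if_neg hi.ne)
  out := h.out
  scratch := h.scratch

theorem Holds.snd {a : α × ℕ} (h : Holds loc o b a S) : S (loc (arity α)) = a.2 :=
  (h.var _ (Nat.lt_succ_self _)).trans (if_pos rfl)

theorem Holds.iterate (h : Holds loc o b a S) (c i x : ℕ) :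
    Holds (update (update loc (arity α) (b + 1)) (arity α + 1) o) (b + 2) (b + 3) ((a, i), x)
      (update (update (update S b c) (b + 1) i) o x) := by
  have harity : ∀ k, k < arity ((α × ℕ) × ℕ) ↔ k < arity α + 2 := fun _ => Iff.rfl
  have hvar : ∀ k, Context.var ((a, i), x) k =
    if k = arity α + 1 then x else if k = arity α then i else Context.var a k := fun _ => rfl
  have hob := h.out_lt
  refine ⟨fun k hk => ?_, fun k hk => ?_, by omega, fun k hk => ?_, ?_, fun r hr => ?_⟩
  · rw [harity] at hk
    have hlt := h.loc_lt k
    grind [update_apply]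
  · rw [harity] at hk
    have hlt := h.loc_lt k
    grind [update_apply]
  · rw [harity] at hk
    rw [hvar]
    have hlt := h.loc_lt k
    have hne := h.loc_ne k
    have hk' := h.var k
    grind [update_apply]
  · have hscratch := h.scratch (b + 2)
    grind [update_apply]
  · have hscratch := h.scratch r
    grind [update_apply]

end Holds

/-- The program writes `f a` to the register `o` in time `T`, and leaves all else unchanged. -/
def ProgComputes (f : α → ℕ) (T : Polynomial ℕ) (loc : ℕ → ℕ) (o b : ℕ) (p : Prog A) : Prop :=
  ∀ a S, Holds loc o b a S → Runs (str a) p S 0 (update S o (f a)) 0 (T.eval (size a))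

/-- The function `f` has polynomially bounded values and is computed in polynomial time by
programs, wherever its arguments and its value are located. -/
def PolyTime (f : α → ℕ) : Prop :=
  ∃ T : Polynomial ℕ, (∀ a, f a ≤ T.eval (size a)) ∧ ∀ loc o b, ∃ p, ProgComputes f T loc o b p

theorem monotone_eval_nat (T : Polynomial ℕ) : Monotone fun n => T.eval n := by
  intro x y h
  induction T using Polynomial.induction_on' with
  | add p q hp hq => simpa only [Polynomial.eval_add] using add_le_add hp hq
  | monomial n a =>
    simpa only [Polynomial.eval_monomial] using Nat.mul_le_mul_left a (Nat.pow_le_pow_left h n)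

theorem ProgComputes.iterate {g n : α → ℕ} {h : (α × ℕ) × ℕ → ℕ} {f : α → ℕ → ℕ}
    {Tg Th Tn Q T : Polynomial ℕ} {loc : ℕ → ℕ} {o b : ℕ} {pg pn ph : Prog A}
    (hpg : ProgComputes g Tg loc o (b + 1) pg) (hpn : ProgComputes n Tn loc b (b + 1) pn)
    (hph : ProgComputes h Th (update (update loc (arity α) (b + 1)) (arity α + 1) o) (b + 2)
      (b + 3) ph)
    (hzero : ∀ a, f a 0 = g a) (hsucc : ∀ a i, f a (i + 1) = h ((a, i), f a i))
    (hTn : ∀ a, n a ≤ Tn.eval (size a)) (hQ : ∀ a, ∀ i ≤ n a, f a i ≤ Q.eval (size a))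
    (hT : ∀ a, ∀ i ≤ n a, Th.eval (size ((a, i), f a i)) ≤ T.eval (size a)) :
    ProgComputes (fun a => f a (n a)) (Tn + Tg + (Tn * (T + Q * 4 + 4) + Tn * 2 + 2)) loc o b
      (.seq (.seq pn pg) (.iterate ph o b)) := by
  intro a S hS
  have hob := hS.out_lt
  have hb := hS.scratch
  have hround : ∀ z y c i x,
      update (update (update (update (update S b z) o y) b c) (b + 1) i) o x =
        update (update (update S b c) (b + 1) i) o x := by
    intro z y c i x
    grind [update_apply]
  have hfinal : ∀ z y x, update (update (update (update S b z) o y) b 0) o x = update S o x := by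
    intro z y x
    grind [update_apply]
  have hiter : Runs (str a) (.iterate ph o b) (update (update S b (n a)) o (g a)) 0 _ 0 _ :=
    Runs.iterate (n := n a) (q := Q.eval (size a)) (f := f a) (t := T.eval (size a)) hob
      (by simp [hob.ne']) (by simp [hb, (hob.trans b.lt_succ_self).ne'])
      (by simp [hb, (hob.trans (Nat.lt_add_of_pos_right two_pos)).ne'])
      (by simp [hzero]) (hQ a) fun i hi c => by
        rw [hround, hsucc]
        exact (hph ((a, i), f a i) _ (hS.iterate c i (f a i))).mono (hT a i hi.le)
  refine (((hpn a S hS.out_scratch).seq (hpg a _ (hS.update_scratch _))).seq hiter).congr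
    (hfinal _ _ _) rfl ?_
  have := Nat.mul_le_mul_right (T.eval (size a) + Q.eval (size a) * 4 + 4) (hTn a)
  have := hTn a
  simp only [Polynomial.eval_add, Polynomial.eval_mul, Polynomial.eval_ofNat]
  omega

namespace PolyTime

theorem zero : PolyTime fun _ : α => 0 :=
  ⟨1, fun _ => Nat.zero_le _, fun _ o _ => ⟨.skip, fun a S hS =>
    Runs.skip.congr (update_eq_self_iff.2 hS.out.symm).symm rfl (by simp)⟩⟩

theorem succ {f : α → ℕ} (hf : PolyTime f) : PolyTime fun a => f a + 1 := by
  obtain ⟨T, hT, hp⟩ := hf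
  refine ⟨T + 1, fun a => by simpa using hT a, fun loc o b => ?_⟩
  obtain ⟨p, hp⟩ := hp loc o b
  exact ⟨.seq p (.inc o), fun a S hS =>
    ((hp a S hS).seq Runs.inc).congr (by simp) rfl (by simp)⟩

theorem comp_fst {f : α → ℕ} (hf : PolyTime f) : PolyTime fun a : α × ℕ => f a.1 := by
  obtain ⟨T, hT, hp⟩ := hf
  have hle : ∀ a : α × ℕ, T.eval (size a.1) ≤ T.eval (size a) := fun a =>
    monotone_eval_nat T (by rw [← Prod.eta a, size_prod]; exact Nat.le_add_right _ _)
  refine ⟨T, fun a => (hT a.1).trans (hle a), fun loc o b => ?_⟩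
  obtain ⟨p, hp⟩ := hp loc o b
  exact ⟨p, fun a S hS => (hp a.1 S hS.fst).mono (hle a)⟩

theorem snd : PolyTime fun a : α × ℕ => a.2 := by
  have hle : ∀ a : α × ℕ, a.2 ≤ size a := fun a => by
    rw [← Prod.eta a, size_prod]; exact Nat.le_add_left _ _
  refine ⟨5 * Polynomial.X + 2, fun a => ?_, fun loc o b =>
    ⟨.copy (loc (arity α)) b o, fun a S hS => ?_⟩⟩
  · have := hle a
    simp only [Polynomial.eval_add, Polynomial.eval_mul, Polynomial.eval_ofNat, Polynomial.eval_X]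
    omega
  · have := hle a
    refine (Runs.copy (hS.loc_lt _ (Nat.lt_succ_self _)).ne (hS.loc_ne _ (Nat.lt_succ_self _))
      hS.out_lt.ne' (hS.scratch b le_rfl)).congr ?_ rfl ?_
    · rw [hS.out, hS.snd, zero_add]
    · rw [hS.snd]
      simp only [Polynomial.eval_add, Polynomial.eval_mul, Polynomial.eval_ofNat,
        Polynomial.eval_X]
      omega

/-- The bound `Q` on all values keeps the unary registers, and so the running time, polynomial. -/
theorem prec {g n : α → ℕ} {h : (α × ℕ) × ℕ → ℕ} {f : α → ℕ → ℕ} (hg : PolyTime g)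
    (hh : PolyTime h) (hn : PolyTime n) (hzero : ∀ a, f a 0 = g a)
    (hsucc : ∀ a i, f a (i + 1) = h ((a, i), f a i)) (Q : Polynomial ℕ)
    (hQ : ∀ a, ∀ i ≤ n a, f a i ≤ Q.eval (size a)) : PolyTime fun a => f a (n a) := by
  obtain ⟨Tg, -, hpg⟩ := hg
  obtain ⟨Th, -, hph⟩ := hh
  obtain ⟨Tn, hTn, hpn⟩ := hn
  have hT : ∀ a, ∀ i ≤ n a, Th.eval (size ((a, i), f a i)) ≤
      (Th.comp (Polynomial.X + Tn + Q)).eval (size a) := by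
    intro a i hi
    rw [Polynomial.eval_comp, size_prod, size_prod]
    simp only [Polynomial.eval_add, Polynomial.eval_X]
    exact monotone_eval_nat Th (add_le_add (Nat.add_le_add_left (hi.trans (hTn a)) _) (hQ a i hi))
  refine ⟨Tn + Tg + (Tn * (Th.comp (Polynomial.X + Tn + Q) + Q * 4 + 4) + Tn * 2 + 2) + Q,
    fun a => ?_, fun loc o b => ?_⟩
  · rw [Polynomial.eval_add]
    exact le_add_left (hQ a (n a) le_rfl)
  obtain ⟨pn, hpn⟩ := hpn loc b (b + 1)
  obtain ⟨pg, hpg⟩ := hpg loc o (b + 1)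
  obtain ⟨ph, hph⟩ := hph (update (update loc (arity α) (b + 1)) (arity α + 1) o) (b + 2) (b + 3)
  exact ⟨_, fun a S hS => (hpg.iterate hpn hph hzero hsucc hTn hQ hT a S hS).mono
    ((Nat.le_add_right _ _).trans_eq Polynomial.eval_add.symm)⟩

theorem letter {x : α → ℕ} (hx : PolyTime x) (q : A → Bool) :
    PolyTime fun a => if (str a)[x a]?.any q then 1 else 0 := by
  obtain ⟨T, hT, hp⟩ := hx
  refine ⟨T * 6 + 3, fun a => ?_, fun loc o b => ?_⟩
  · simp only [Polynomial.eval_add, Polynomial.eval_ofNat]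
    split_ifs <;> omega
  obtain ⟨p, hp⟩ := hp loc b (b + 1)
  refine ⟨.seq (.seq p (.seek b (b + 1))) (.seq (.test q o) (.rewind (b + 1))), fun a S hS => ?_⟩
  have hob := hS.out_lt
  have hb : ∀ r, b ≤ r → S r = 0 := hS.scratch
  have ho := hS.out
  have hmin : (str a)[min (x a) (str a).length]? = (str a)[x a]? := by grind
  refine (((hp a S hS.out_scratch).seq (Runs.seek (by omega) (by grind [update_apply]))).seq
    (Runs.test.seq Runs.rewind)).congr ?_ ?_ ?_
  · grind [update_apply]
  · grind [update_apply]
  · have := hT a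
    simp only [Polynomial.eval_add, Polynomial.eval_mul, Polynomial.eval_ofNat]
    grind [update_apply]

theorem length : PolyTime fun a : α => (str a).length := by
  refine ⟨Polynomial.X * 7 + 8, fun a => ?_, fun loc o b =>
    ⟨.seq (.inc b) (.seq (.scan b (b + 1) o) (.rewind (b + 1))), fun a S hS => ?_⟩⟩
  all_goals
    have := length_str_le_size a
    simp only [Polynomial.eval_add, Polynomial.eval_mul, Polynomial.eval_ofNat, Polynomial.eval_X]
  · omega
  · have hob := hS.out_lt
    have hb : ∀ r, b ≤ r → S r = 0 := hS.scratch
    have ho := hS.out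
    exact (Runs.inc.seq ((Runs.scan (by omega) (by omega) (by omega) (by grind [update_apply])
      (by grind [update_apply]) (by grind [update_apply])).seq Runs.rewind)).congr
      (by grind [update_apply]) (by grind [update_apply]) (by grind [update_apply])

end PolyTime

end PolynomialTime

section Arithmetic

open Context

variable {A α : Type} [Context A α]

/-! ### Arithmetic and bounded quantifiers in polynomial time -/

theorem count_eq_of_iff_lt {P : ℕ → Prop} [DecidablePred P] {N k : ℕ} (hk : k ≤ N)
    (hP : ∀ i < N, (P i ↔ i < k)) : Nat.count P N = k := by
  have hfilter : (Finset.range N).filter P = Finset.range k := by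
    ext i
    simp only [Finset.mem_filter, Finset.mem_range]
    exact ⟨fun h => (hP i h.1).1 h.2, fun h => ⟨h.trans_le hk, (hP i (h.trans_le hk)).2 h⟩⟩
  rw [Nat.count_eq_card_filter_range, hfilter, Finset.card_range]

namespace PolyTime

variable {f g x y n : α → ℕ}

theorem of_eq (hf : PolyTime f) (h : ∀ a, f a = g a) : PolyTime g := (funext h : f = g) ▸ hf

theorem const (k : ℕ) : PolyTime fun _ : α => k := by
  induction k with
  | zero => exact zero
  | succ k ih => exact ih.succ

theorem add (hx : PolyTime x) (hy : PolyTime y) : PolyTime fun a => x a + y a := by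
  obtain ⟨Tx, hTx, -⟩ := id hx
  obtain ⟨Ty, hTy, -⟩ := id hy
  refine prec (f := fun a i => x a + i) (h := fun p => p.2 + 1) hx snd.succ hy
    (fun _ => rfl) (fun _ _ => rfl) (Tx + Ty) fun a i hi => ?_
  rw [Polynomial.eval_add]
  exact add_le_add (hTx a) (hi.trans (hTy a))

theorem sum {g : α → ℕ → ℕ} (hn : PolyTime n) (hg : PolyTime fun p : α × ℕ => g p.1 p.2) :
    PolyTime fun a => ∑ i ∈ Finset.range (n a), g a i := by
  obtain ⟨Tn, hTn, -⟩ := id hn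
  obtain ⟨Tg, hTg, -⟩ := id hg
  refine prec (f := fun a i => ∑ k ∈ Finset.range i, g a k) (h := fun p => p.2 + g p.1.1 p.1.2)
    zero (snd.add hg.comp_fst) hn (fun _ => rfl) (fun _ _ => Finset.sum_range_succ _ _)
    (Tn * Tg.comp (Polynomial.X + Tn)) fun a i hi => ?_
  have hterm : ∀ k ∈ Finset.range i, g a k ≤ (Tg.comp (Polynomial.X + Tn)).eval (size a) := by
    intro k hk
    refine (hTg (a, k)).trans ?_
    rw [Polynomial.eval_comp, size_prod, Polynomial.eval_add, Polynomial.eval_X]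
    exact monotone_eval_nat Tg
      (Nat.add_le_add_left (((Finset.mem_range.1 hk).le.trans hi).trans (hTn a)) _)
  calc ∑ k ∈ Finset.range i, g a k
      ≤ (Finset.range i).card • (Tg.comp (Polynomial.X + Tn)).eval (size a) :=
        Finset.sum_le_card_nsmul _ _ _ hterm
    _ = i * (Tg.comp (Polynomial.X + Tn)).eval (size a) := by rw [Finset.card_range, smul_eq_mul]
    _ ≤ (Tn * Tg.comp (Polynomial.X + Tn)).eval (size a) := by
        rw [Polynomial.eval_mul]
        exact Nat.mul_le_mul_right _ (hi.trans (hTn a))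

theorem mul (hx : PolyTime x) (hy : PolyTime y) : PolyTime fun a => x a * y a :=
  (sum hx (g := fun a _ => y a) hy.comp_fst).of_eq fun a => by simp

theorem pred (hx : PolyTime x) : PolyTime fun a => x a - 1 := by
  obtain ⟨T, hT, -⟩ := id hx
  exact prec (f := fun _ i => i - 1) (h := fun p => p.1.2) zero snd.comp_fst hx
    (fun _ => rfl) (fun _ _ => rfl) T fun a i hi => ((Nat.sub_le i 1).trans hi).trans (hT a)

theorem sub (hx : PolyTime x) (hy : PolyTime y) : PolyTime fun a => x a - y a := by
  obtain ⟨T, hT, -⟩ := id hx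
  exact prec (f := fun a i => x a - i) (h := fun p => p.2 - 1) hx snd.pred hy
    (fun _ => rfl) (fun _ _ => rfl) T fun a i _ => (Nat.sub_le _ i).trans (hT a)

end PolyTime

/-- The predicate `P` is decidable in polynomial time: it is the support of a function that is
computable in polynomial time. -/
def PolyTimePred (P : α → Prop) : Prop := ∃ f : α → ℕ, PolyTime f ∧ ∀ a, P a ↔ f a ≠ 0

theorem PolyTime.indicator {P : α → Prop} [DecidablePred P] (hP : PolyTimePred P) :
    PolyTime fun a => if P a then 1 else 0 := by
  obtain ⟨f, hf, hP⟩ := hP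
  refine ((const 1).sub ((const 1).sub hf)).of_eq fun a => ?_
  simp only [hP a]
  split_ifs <;> omega

theorem PolyTime.count {n : α → ℕ} {P : α → ℕ → Prop} [∀ a, DecidablePred (P a)]
    (hn : PolyTime n) (hP : PolyTimePred fun p : α × ℕ => P p.1 p.2) :
    PolyTime fun a => Nat.count (P a) (n a) :=
  (hn.sum (g := fun a i => if P a i then 1 else 0) (indicator hP)).of_eq fun a => by
    rw [Nat.count_eq_card_filter_range, Finset.card_filter]

theorem PolyTime.half {x : α → ℕ} (hx : PolyTime x) : PolyTime fun a => x a / 2 := by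
  have hlt : PolyTimePred fun p : α × ℕ => p.2 + p.2 + 1 < x p.1 :=
    ⟨_, hx.comp_fst.sub (snd.add snd).succ, fun a => by omega⟩
  exact (hx.count (P := fun a i => i + i + 1 < x a) hlt).of_eq fun a =>
    count_eq_of_iff_lt (Nat.div_le_self _ _) fun i _ => by omega

namespace PolyTimePred

variable {P Q : α → Prop} {x y n : α → ℕ}

theorem of_iff (hP : PolyTimePred P) (h : ∀ a, P a ↔ Q a) : PolyTimePred Q :=
  (funext fun a => propext (h a) : P = Q) ▸ hP

theorem lt (hx : PolyTime x) (hy : PolyTime y) : PolyTimePred fun a => x a < y a :=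
  ⟨_, hy.sub hx, fun _ => Nat.sub_ne_zero_iff_lt.symm⟩

theorem not (hP : PolyTimePred P) : PolyTimePred fun a => ¬ P a := by
  obtain ⟨f, hf, hP⟩ := hP
  exact ⟨_, (PolyTime.const 1).sub hf, fun a => by simp only [hP a]; omega⟩

theorem le (hx : PolyTime x) (hy : PolyTime y) : PolyTimePred fun a => x a ≤ y a :=
  (lt hy hx).not.of_iff fun _ => not_lt

theorem and (hP : PolyTimePred P) (hQ : PolyTimePred Q) : PolyTimePred fun a => P a ∧ Q a := by
  obtain ⟨f, hf, hP⟩ := hP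
  obtain ⟨g, hg, hQ⟩ := hQ
  exact ⟨_, hf.mul hg, fun a => by simp only [hP a, hQ a, mul_ne_zero_iff]⟩

theorem or (hP : PolyTimePred P) (hQ : PolyTimePred Q) : PolyTimePred fun a => P a ∨ Q a :=
  (hP.not.and hQ.not).not.of_iff fun a => by tauto

theorem imp (hP : PolyTimePred P) (hQ : PolyTimePred Q) : PolyTimePred fun a => P a → Q a :=
  (hP.not.or hQ).of_iff fun _ => imp_iff_not_or.symm

theorem iff (hP : PolyTimePred P) (hQ : PolyTimePred Q) : PolyTimePred fun a => (P a ↔ Q a) :=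
  ((hP.imp hQ).and (hQ.imp hP)).of_iff fun _ => iff_def.symm

theorem eq (hx : PolyTime x) (hy : PolyTime y) : PolyTimePred fun a => x a = y a :=
  ((le hx hy).and (le hy hx)).of_iff fun _ => le_antisymm_iff.symm

theorem ne (hx : PolyTime x) (hy : PolyTime y) : PolyTimePred fun a => x a ≠ y a := (eq hx hy).not

open scoped Classical in
theorem ex {P : α → ℕ → Prop} (hn : PolyTime n) (hP : PolyTimePred fun p : α × ℕ => P p.1 p.2) :
    PolyTimePred fun a => ∃ i < n a, P a i :=
  ⟨_, hn.count hP, fun _ => Nat.count_ne_iff_exists.symm⟩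

theorem all {P : α → ℕ → Prop} (hn : PolyTime n) (hP : PolyTimePred fun p : α × ℕ => P p.1 p.2) :
    PolyTimePred fun a => ∀ i < n a, P a i :=
  (ex hn (P := fun a i => ¬ P a i) hP.not).not.of_iff fun a => by push Not; rfl

theorem letter (hx : PolyTime x) (l : A) :
    PolyTimePred fun a => (str a)[x a]? = some l := by
  classical exact ⟨_, hx.letter (· = l), fun a => by simp [Option.any_eq_true]⟩

end PolyTimePred

theorem PolyTime.ite {P : α → Prop} [DecidablePred P] {x y : α → ℕ} (hP : PolyTimePred P)
    (hx : PolyTime x) (hy : PolyTime y) : PolyTime fun a => if P a then x a else y a :=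
  (((indicator hP).mul hx).add ((indicator hP.not).mul hy)).of_eq fun a => by
    split_ifs <;> simp

open scoped Classical in
theorem PolyTimePred.inP [Finite A] [Inhabited A] {I : Type} {enc : I → List A} {Yes : I → Prop}
    {P : List A → Prop} (hP : PolyTimePred P) (h : ∀ a, P (enc a) ↔ Yes a) : InP enc Yes := by
  obtain ⟨T, -, hp⟩ := PolyTime.indicator hP
  obtain ⟨p, hp⟩ := hp id 0 1
  refine inP_of_runs (fun a => decide (Yes a)) (fun a => decide_eq_true_iff) p T fun a => ?_
  have hzero : Holds id 0 1 (enc a) 0 :=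
    ⟨fun i hi => absurd hi (Nat.not_lt_zero i), fun i hi => absurd hi (Nat.not_lt_zero i), one_pos,
      fun i hi => absurd hi (Nat.not_lt_zero i), rfl, fun _ _ => rfl⟩
  have hsize : size (enc a) = (enc a).length := by simp [size, str, arity]
  have hval : (if P (enc a) then 1 else 0) = (decide (Yes a)).toNat := by simp [h a, Bool.toNat]
  rw [← hval, ← hsize]
  exact hp (enc a) 0 hzero

end Arithmetic

section DecisionProcedure

open Context

/-! ### The decision procedure

All quantities are read off from the encoding `s`. Numbers in `s` are addressed by their index
among all numbers of `s`, and a candidate is addressed by its position in the tie-breaking order. -/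

section Procedure

variable (s : List Letter)

/-- The position of the occurrence number `t` of the letter `l`. -/
noncomputable def occPos (l : Letter) (t : ℕ) : ℕ :=
  Nat.count (fun i => (s.take (i + 1)).count l ≤ t) s.length

/-- The letter at position `k` is a binary digit. -/
def IsDigit (k : ℕ) : Prop := s[k]? = some (.bit true) ∨ s[k]? = some (.bit false)

open Classical in
/-- The position of the first digit of the number with index `t`. -/
noncomputable def numStart (t : ℕ) : ℕ :=
  Nat.count (fun i => ∃ k < occPos s .endNum t, i ≤ k ∧ ¬ IsDigit s k) (occPos s .endNum t)

/-- The binary digit `j` of the number with index `t` is one. -/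
def NumBit (t j : ℕ) : Prop :=
  numStart s t + j < occPos s .endNum t ∧ s[numStart s t + j]? = some (.bit true)

/-- The number with index `t` is negative. -/
def NumNeg (t : ℕ) : Prop := 0 < numStart s t ∧ s[numStart s t - 1]? = some .minus

/-- The numbers with indices `t` and `u` have the same absolute value. -/
def NumEq (t u : ℕ) : Prop := ∀ j < s.length, (NumBit s t j ↔ NumBit s u j)

open Classical in
/-- The number of ones among the digits `j` of the positive numbers with indices `f w` and of the
negative numbers with indices `g w`, where `w < n`. -/
noncomputable def column (n : ℕ) (f g : ℕ → ℕ) (j : ℕ) : ℕ :=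
  Nat.count (fun w => NumBit s (f w) j ∧ ¬ NumNeg s (f w)) n +
    Nat.count (fun w => NumBit s (g w) j ∧ NumNeg s (g w)) n

/-- The carry before digit `j` in the subtraction of the sum of the numbers with indices `g w` from
the sum of those with indices `f w`, where `w < n`. The carry is at least `- 2 * n`, and it is
shifted by `2 * n` to make it a natural number. -/
noncomputable def carry (n : ℕ) (f g : ℕ → ℕ) : ℕ → ℕ
  | 0 => 2 * n
  | j + 1 => (carry n f g j + 2 * n + column s n f g j - column s n g f j) / 2

/-- The sum of the numbers with indices `f w` is less than the sum of those with indices `g w`,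
where `w < n`: the last carry of the subtraction is negative. -/
def SumLT (n : ℕ) (f g : ℕ → ℕ) : Prop := carry s n f g s.length < 2 * n

/-- The number of candidates. The denominator of the scoring vector and its numerators are the
numbers before the first end of a block. -/
noncomputable def candCount : ℕ := (s.take (occPos s .endBlock 0)).count .endNum - 1

/-- The number of voters, if the encoding contains `k` blocks that are not votes. -/
noncomputable def voterCount (k : ℕ) : ℕ := s.count .endBlock - k

/-- The index of the number that names the candidate `a`. -/
noncomputable def candIdx (a : ℕ) : ℕ := 1 + candCount s + a

/-- The index of the number that names the candidate at position `i` in the vote `w`. -/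
noncomputable def voteIdx (w i : ℕ) : ℕ := 1 + candCount s + candCount s * (w + 1) + i

open Classical in
/-- The position of the candidate `a` in the vote `w`. -/
noncomputable def votePos (w a : ℕ) : ℕ :=
  ∑ i ∈ Finset.range (candCount s), if NumEq s (voteIdx s w i) (candIdx s a) then i else 0

/-- The index of the score of the candidate `a` in the vote `w`, provided the vote `v` has been
changed so that it places `a` at position `i`. -/
noncomputable def scoreIdx (v a i w : ℕ) : ℕ := 1 + if w = v then i else votePos s w a

/-- The candidate `b` is ahead of the candidate `a`, provided the vote `v` has been changed so that
it places `b` at position `p` and `a` at position `i`. -/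
def Ahead (n v b p a i : ℕ) : Prop :=
  (a < b → SumLT s n (scoreIdx s v a i) (scoreIdx s v b p)) ∧
    (b ≤ a → ¬ SumLT s n (scoreIdx s v b p) (scoreIdx s v a i))

/-- The candidate `x` wins if no vote is changed; the number `n` of the voters serves as the name of
a voter who does not exist. -/
def Wins (n x : ℕ) : Prop := ∀ c < candCount s, c ≠ x → Ahead s n n x 0 c 0

open Classical in
/-- Hall's condition for changing the vote `v` so that it places `y` at position `p` and `x` at
position `q`, and so that all candidates but `x` stay behind `y`. -/
def Placeable (n v x y p q : ℕ) : Prop :=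
  ∀ i < candCount s, i ≠ p → i ≠ q → Nat.count (fun j => j ≤ i ∧ j ≠ p ∧ j ≠ q) (candCount s) ≤
    Nat.count (fun c => Ahead s n v y p c i ∧ c ≠ x ∧ c ≠ y) (candCount s)

/-- The voter `v` is a possible manipulator against `y`. -/
def Suspect (n v y : ℕ) : Prop :=
  ∃ x < candCount s, Wins s n x ∧ x ≠ y ∧ ∃ p < candCount s, ∃ q < p,
    Ahead s n v y p x q ∧ Placeable s n v x y p q

/-- The voter `v` belongs to the given coalition. -/
def Member (n v : ℕ) : Prop := s[occPos s .endBlock (n + 2) + 1 + v]? = some (.bit true)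

/-- The candidate `a` is the given candidate, whose name follows the last vote. -/
def IsGiven (n a : ℕ) : Prop := NumEq s (candIdx s a) (voteIdx s n 0)

/-- The decision procedure for `CPMW` with a single suspect. -/
def DecideCPMW : Prop :=
  ∃ v < voterCount s 4, Member s (voterCount s 4) v ∧
    ∃ y < candCount s, IsGiven s (voterCount s 4) y ∧ Suspect s (voterCount s 4) v y

/-- The decision procedure for `CPM` with a single suspect. -/
def DecideCPM : Prop :=
  ∃ v < voterCount s 4, Member s (voterCount s 4) v ∧
    ∃ y < candCount s, Suspect s (voterCount s 4) v y

/-- The decision procedure for `CPMSW` with coalitions of size at most one. -/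
def DecideCPMSW : Prop :=
  ∃ v < voterCount s 3, ∃ y < candCount s, IsGiven s (voterCount s 3) y ∧
    Suspect s (voterCount s 3) v y

/-- The decision procedure for `CPMS` with coalitions of size at most one. -/
def DecideCPMS : Prop :=
  ∃ v < voterCount s 3, ∃ y < candCount s, Suspect s (voterCount s 3) v y

end Procedure

theorem count_take (s : List Letter) (l : Letter) (i : ℕ) :
    (s.take i).count l = Nat.count (fun k => s[k]? = some l) i := by
  induction i with
  | zero => simp
  | succ i ih =>
    rw [List.take_add_one, List.count_append, ih, Nat.count_succ]
    rcases s[i]? with _ | l' <;> simp [List.count_singleton]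

open Classical in
theorem column_le (s : List Letter) (n : ℕ) (f g : ℕ → ℕ) (j : ℕ) : column s n f g j ≤ 2 * n :=
  (add_le_add (Nat.count_le _) (Nat.count_le _)).trans_eq (two_mul n).symm

theorem carry_le (s : List Letter) (n : ℕ) (f g : ℕ → ℕ) (j : ℕ) : carry s n f g j ≤ 4 * n := by
  induction j with
  | zero => rw [carry]; omega
  | succ j ih =>
    have := column_le s n f g j
    rw [carry]
    omega

section PolyTime

variable {α : Type} [Context Letter α] {n v a b i j k p q t u w x y : α → ℕ}

theorem PolyTime.count_take (l : Letter) (hi : PolyTime i) :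
    PolyTime fun c => ((str c).take (i c)).count l :=
  (hi.count (PolyTimePred.letter snd l)).of_eq fun _ =>
    (PossibleManipulators.count_take _ _ _).symm

theorem PolyTime.count_str (l : Letter) : PolyTime fun c : α => (str c).count l :=
  (count_take l length).of_eq fun _ => by rw [List.take_length]

theorem PolyTime.occPos (l : Letter) (ht : PolyTime t) : PolyTime fun c => occPos (str c) l (t c) :=
  length.count (.le (count_take l snd.succ) ht.comp_fst)

theorem PolyTimePred.isDigit (hi : PolyTime i) : PolyTimePred fun c => IsDigit (str c) (i c) :=
  (letter hi _).or (letter hi _)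

open Classical in
theorem PolyTime.numStart (ht : PolyTime t) : PolyTime fun c => numStart (str c) (t c) :=
  (ht.occPos _).count <| .ex (ht.occPos _).comp_fst <| (PolyTimePred.le snd.comp_fst snd).and
    (PolyTimePred.isDigit snd).not

theorem PolyTimePred.numBit (ht : PolyTime t) (hj : PolyTime j) :
    PolyTimePred fun c => NumBit (str c) (t c) (j c) :=
  (lt (ht.numStart.add hj) (ht.occPos _)).and (letter (ht.numStart.add hj) _)

theorem PolyTimePred.numNeg (ht : PolyTime t) : PolyTimePred fun c => NumNeg (str c) (t c) :=
  (lt .zero ht.numStart).and (letter ht.numStart.pred _)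

theorem PolyTimePred.numEq (ht : PolyTime t) (hu : PolyTime u) :
    PolyTimePred fun c => NumEq (str c) (t c) (u c) :=
  all .length ((numBit ht.comp_fst .snd).iff (numBit hu.comp_fst .snd))

section SumLT

variable {f g : α → ℕ → ℕ}

open Classical in
theorem PolyTime.column (hn : PolyTime n) (hf : PolyTime fun c : α × ℕ => f c.1 c.2)
    (hg : PolyTime fun c : α × ℕ => g c.1 c.2) (hj : PolyTime j) :
    PolyTime fun c => column (str c) (n c) (f c) (g c) (j c) :=
  (hn.count ((PolyTimePred.numBit hf hj.comp_fst).and (PolyTimePred.numNeg hf).not)).add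
    (hn.count ((PolyTimePred.numBit hg hj.comp_fst).and (PolyTimePred.numNeg hg)))

theorem PolyTime.carry (hn : PolyTime n) (hf : PolyTime fun c : (α × ℕ) × ℕ => f c.1.1 c.2)
    (hg : PolyTime fun c : (α × ℕ) × ℕ => g c.1.1 c.2) (hj : PolyTime j) :
    PolyTime fun c => carry (str c) (n c) (f c) (g c) (j c) := by
  obtain ⟨T, hT, -⟩ := id hn
  have h2n : PolyTime fun c => 2 * n c := (const 2).mul hn
  have hfg := column (f := fun c => f c.1) (g := fun c => g c.1) hn.comp_fst hf hg snd
  have hgf := column (f := fun c => g c.1) (g := fun c => f c.1) hn.comp_fst hg hf snd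
  refine prec h2n (((snd.add h2n.comp_fst.comp_fst).add hfg.comp_fst).sub hgf.comp_fst).half hj
    (fun c => rfl) (fun c j => rfl) (4 * T) fun c j _ => (carry_le _ _ _ _ j).trans ?_
  rw [Polynomial.eval_mul, Polynomial.eval_ofNat]
  exact Nat.mul_le_mul_left 4 (hT c)

theorem PolyTimePred.sumLT (hn : PolyTime n) (hf : PolyTime fun c : (α × ℕ) × ℕ => f c.1.1 c.2)
    (hg : PolyTime fun c : (α × ℕ) × ℕ => g c.1.1 c.2) :
    PolyTimePred fun c => SumLT (str c) (n c) (f c) (g c) :=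
  lt (hn.carry hf hg .length) ((PolyTime.const 2).mul hn)

end SumLT

theorem PolyTime.candCount : PolyTime fun c : α => candCount (str c) :=
  (count_take _ (zero.occPos _)).pred

theorem PolyTime.voterCount (k : ℕ) : PolyTime fun c : α => voterCount (str c) k :=
  (count_str _).sub (const k)

theorem PolyTime.candIdx (ha : PolyTime a) : PolyTime fun c => candIdx (str c) (a c) :=
  ((const 1).add candCount).add ha

theorem PolyTime.voteIdx (hw : PolyTime w) (hi : PolyTime i) :
    PolyTime fun c => voteIdx (str c) (w c) (i c) :=
  (((const 1).add candCount).add (candCount.mul hw.succ)).add hi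

open Classical in
theorem PolyTime.votePos (hw : PolyTime w) (ha : PolyTime a) :
    PolyTime fun c => votePos (str c) (w c) (a c) :=
  candCount.sum <| ite (.numEq (hw.comp_fst.voteIdx snd) ha.comp_fst.candIdx) snd zero

theorem PolyTime.scoreIdx (hv : PolyTime v) (ha : PolyTime a) (hi : PolyTime i)
    (hw : PolyTime w) : PolyTime fun c => scoreIdx (str c) (v c) (a c) (i c) (w c) :=
  (const 1).add (ite (.eq hw hv) hi (hw.votePos ha))

theorem PolyTimePred.ahead (hn : PolyTime n) (hv : PolyTime v) (hb : PolyTime b) (hp : PolyTime p)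
    (ha : PolyTime a) (hi : PolyTime i) :
    PolyTimePred fun c => Ahead (str c) (n c) (v c) (b c) (p c) (a c) (i c) :=
  have hidx {a i : α → ℕ} (ha : PolyTime a) (hi : PolyTime i) :
      PolyTime fun c : (α × ℕ) × ℕ => scoreIdx (str c.1.1) (v c.1.1) (a c.1.1) (i c.1.1) c.2 :=
    hv.comp_fst.comp_fst.scoreIdx ha.comp_fst.comp_fst hi.comp_fst.comp_fst .snd
  ((lt ha hb).imp (sumLT hn (hidx ha hi) (hidx hb hp))).and
    ((le hb ha).imp (sumLT hn (hidx hb hp) (hidx ha hi)).not)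

theorem PolyTimePred.wins (hn : PolyTime n) (hx : PolyTime x) :
    PolyTimePred fun c => Wins (str c) (n c) (x c) :=
  all .candCount <| (ne .snd hx.comp_fst).imp <|
    ahead hn.comp_fst hn.comp_fst hx.comp_fst .zero .snd .zero

open Classical in
theorem PolyTimePred.placeable (hn : PolyTime n) (hv : PolyTime v) (hx : PolyTime x)
    (hy : PolyTime y) (hp : PolyTime p) (hq : PolyTime q) :
    PolyTimePred fun c => Placeable (str c) (n c) (v c) (x c) (y c) (p c) (q c) :=
  all .candCount <| (ne .snd hp.comp_fst).imp <| (ne .snd hq.comp_fst).imp <| le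
    (PolyTime.candCount.count <| (le .snd PolyTime.snd.comp_fst).and <|
      (ne .snd hp.comp_fst.comp_fst).and (ne .snd hq.comp_fst.comp_fst))
    (PolyTime.candCount.count <| (ahead hn.comp_fst.comp_fst hv.comp_fst.comp_fst
        hy.comp_fst.comp_fst hp.comp_fst.comp_fst .snd PolyTime.snd.comp_fst).and <|
      (ne .snd hx.comp_fst.comp_fst).and (ne .snd hy.comp_fst.comp_fst))

theorem PolyTimePred.suspect (hn : PolyTime n) (hv : PolyTime v) (hy : PolyTime y) :
    PolyTimePred fun c => Suspect (str c) (n c) (v c) (y c) := by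
  refine ex .candCount <| (wins hn.comp_fst .snd).and <| (ne .snd hy.comp_fst).and <|
    ex .candCount <| ex .snd ?_
  have hn' := hn.comp_fst.comp_fst.comp_fst
  have hv' := hv.comp_fst.comp_fst.comp_fst
  have hy' := hy.comp_fst.comp_fst.comp_fst
  have hx : PolyTime fun c : ((α × ℕ) × ℕ) × ℕ => c.1.1.2 := PolyTime.snd.comp_fst.comp_fst
  have hp : PolyTime fun c : ((α × ℕ) × ℕ) × ℕ => c.1.2 := PolyTime.snd.comp_fst
  exact (ahead hn' hv' hy' hp hx .snd).and (placeable hn' hv' hx hy' hp .snd)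

theorem PolyTimePred.member (hn : PolyTime n) (hv : PolyTime v) :
    PolyTimePred fun c => Member (str c) (n c) (v c) :=
  letter (((hn.succ.succ.occPos _).succ).add hv) _

theorem PolyTimePred.isGiven (hn : PolyTime n) (ha : PolyTime a) :
    PolyTimePred fun c => IsGiven (str c) (n c) (a c) :=
  numEq ha.candIdx (hn.voteIdx .zero)

end PolyTime

theorem PolyTimePred.decideCPMW : PolyTimePred DecideCPMW :=
  have hn : PolyTime fun c : List Letter × ℕ => voterCount c.1 4 := .voterCount 4
  ex (.voterCount 4) <| (member hn .snd).and <| ex .candCount <|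
    (isGiven hn.comp_fst .snd).and (suspect hn.comp_fst PolyTime.snd.comp_fst .snd)

theorem PolyTimePred.decideCPM : PolyTimePred DecideCPM :=
  have hn : PolyTime fun c : List Letter × ℕ => voterCount c.1 4 := .voterCount 4
  ex (.voterCount 4) <| (member hn .snd).and <| ex .candCount <|
    suspect hn.comp_fst PolyTime.snd.comp_fst .snd

theorem PolyTimePred.decideCPMSW : PolyTimePred DecideCPMSW :=
  have hn : PolyTime fun c : (List Letter × ℕ) × ℕ => voterCount c.1.1 3 := .voterCount 3
  ex (.voterCount 3) <| ex .candCount <|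
    (isGiven hn .snd).and (suspect hn PolyTime.snd.comp_fst .snd)

theorem PolyTimePred.decideCPMS : PolyTimePred DecideCPMS :=
  ex (.voterCount 3) <| ex .candCount <|
    suspect (.voterCount 3) PolyTime.snd.comp_fst .snd

end DecisionProcedure

section Encoding

/-! ### Reading the encoding -/

theorem occPos_eq {s P B : List Letter} {l : Letter} {t : ℕ} (hs : s = P ++ l :: B)
    (ht : P.count l = t) : occPos s l t = P.length := by
  subst hs ht
  refine count_eq_of_iff_lt (by simp) fun i _ => ⟨fun h => ?_, fun h => ?_⟩
  · by_contra! hi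
    have hprefix : P ++ [l] <+: (P ++ l :: B).take (i + 1) :=
      List.prefix_take_iff.2 ⟨⟨B, by simp⟩, by simpa using hi⟩
    have hcount := hprefix.sublist.count_le l
    rw [List.count_append, List.count_singleton_self] at hcount
    omega
  · rw [List.take_append_of_le_length h]
    exact (List.take_sublist _ _).count_le l

/-- The word `A` is empty or ends with an end mark, so that a number written after `A` is not
preceded by a digit or a sign. -/
def Boundary (A : List Letter) : Prop := ∀ x ∈ A.getLast?, x = .endNum ∨ x = .endBlock

namespace Boundary

variable {A B : List Letter}

theorem nil : Boundary [] := by simp [Boundary]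

theorem concat_endNum (A : List Letter) : Boundary (A ++ [.endNum]) := by simp [Boundary]

theorem concat_endBlock (A : List Letter) : Boundary (A ++ [.endBlock]) := by simp [Boundary]

theorem append (hA : Boundary A) (hB : Boundary B) : Boundary (A ++ B) := by
  intro x hx
  rw [List.getLast?_append] at hx
  rcases h : B.getLast? with _ | y <;> rw [h] at hx
  · exact hA x (by simpa using hx)
  · exact hB x (by simpa [h] using hx)

theorem flatMap {β : Type} {g : β → List Letter} (hg : ∀ x, Boundary (g x)) (L : List β) :
    Boundary (L.flatMap g) := by
  induction L with
  | nil => exact nil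
  | cons x L ih => exact (hg x).append ih

theorem getLast?_ne_bit (hA : Boundary A) (b : Bool) : A.getLast? ≠ some (.bit b) :=
  fun h => by simpa using hA (.bit b) h

theorem getLast?_ne_minus (hA : Boundary A) : A.getLast? ≠ some .minus :=
  fun h => by simpa using hA .minus h

end Boundary

theorem getElem?_encodePosNum (p : PosNum) (j : ℕ) :
    (Computability.encodePosNum p)[j]? = some true ↔ (p : ℕ).testBit j = true := by
  induction p generalizing j with
  | one => cases j <;> simp [Computability.encodePosNum, Nat.testBit_succ]
  | bit0 p ih =>
    cases j with
    | zero => simp [Computability.encodePosNum, ← two_mul]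
    | succ j =>
      rw [Computability.encodePosNum, List.getElem?_cons_succ, ih, PosNum.cast_bit0,
        Nat.testBit_succ, ← two_mul, Nat.mul_div_cancel_left _ two_pos]
  | bit1 p ih =>
    cases j with
    | zero => simp [Computability.encodePosNum, ← two_mul]
    | succ j =>
      rw [Computability.encodePosNum, List.getElem?_cons_succ, ih, PosNum.cast_bit1,
        Nat.testBit_succ, ← two_mul, Nat.mul_add_div two_pos, Nat.div_eq_of_lt one_lt_two,
        add_zero]

theorem getElem?_encodeNat (k j : ℕ) :
    (Computability.encodeNat k)[j]? = some true ↔ k.testBit j = true := by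
  have hk : ((k : Num) : ℕ) = k := Num.to_of_nat k
  conv_rhs => rw [← hk]
  rw [Computability.encodeNat]
  rcases (k : Num) with _ | p
  · simp [Computability.encodeNum]
  · exact getElem?_encodePosNum p j

theorem isDigit_iff {s : List Letter} {k : ℕ} : IsDigit s k ↔ ∃ b, s[k]? = some (.bit b) := by
  simp [IsDigit, or_comm]

section Digits

variable {s A B : List Letter} {d : List Bool} {t : ℕ}

theorem occPos_endNum (hs : s = A ++ (d.map Letter.bit ++ .endNum :: B))
    (ht : A.count .endNum = t) : occPos s .endNum t = A.length + d.length := by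
  rw [occPos_eq (P := A ++ d.map Letter.bit) (B := B) (by simp [hs]), List.length_append,
    List.length_map]
  rw [List.count_append, ht, List.count_eq_zero_of_not_mem (by simp), add_zero]

theorem getElem?_digits (hs : s = A ++ (d.map Letter.bit ++ .endNum :: B)) {j : ℕ}
    (hj : j < d.length) : s[A.length + j]? = some (.bit d[j]) := by
  subst hs
  rw [List.getElem?_append_right (Nat.le_add_right _ _), Nat.add_sub_cancel_left,
    List.getElem?_append_left (by simpa using hj)]
  simp [hj]

open Classical in
theorem numStart_eq (hs : s = A ++ (d.map Letter.bit ++ .endNum :: B))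
    (ht : A.count .endNum = t) (hA : ∀ b, A.getLast? ≠ some (.bit b)) :
    numStart s t = A.length := by
  rw [numStart, occPos_endNum hs ht]
  refine count_eq_of_iff_lt (Nat.le_add_right _ _) fun i _ => ⟨?_, fun h => ?_⟩
  · rintro ⟨k, hk, hik, hd⟩
    by_contra! hi
    obtain ⟨j, rfl⟩ := Nat.exists_eq_add_of_le (hi.trans hik)
    exact hd (isDigit_iff.2 ⟨_, getElem?_digits hs (Nat.add_lt_add_iff_left.1 hk)⟩)
  · refine ⟨A.length - 1, by omega, by omega, fun hd => ?_⟩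
    obtain ⟨b, hb⟩ := isDigit_iff.1 hd
    rw [hs, List.getElem?_append_left (by omega), ← List.getLast?_eq_getElem?] at hb
    exact hA b hb

theorem numBit_iff (hs : s = A ++ (d.map Letter.bit ++ .endNum :: B))
    (ht : A.count .endNum = t) (hA : ∀ b, A.getLast? ≠ some (.bit b)) (j : ℕ) :
    NumBit s t j ↔ d[j]? = some true := by
  rw [NumBit, occPos_endNum hs ht, numStart_eq hs ht hA, Nat.add_lt_add_iff_left]
  constructor
  · rintro ⟨hj, h⟩
    simpa [getElem?_digits hs hj, hj] using h
  · intro h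
    obtain ⟨hj, h⟩ := List.getElem?_eq_some_iff.1 h
    exact ⟨hj, by rw [getElem?_digits hs hj, h]⟩

end Digits

/-- The number with index `t` in the word `s` is `z`. -/
def HasNum (s : List Letter) (t : ℕ) (z : ℤ) : Prop :=
  ∃ A B, s = A ++ (encInt z ++ B) ∧ A.count .endNum = t ∧ Boundary A

theorem encInt_of_nonneg {z : ℤ} (hz : 0 ≤ z) : encInt z = encNat z.natAbs := by
  rw [encInt, if_neg hz.not_gt, List.nil_append]

theorem encInt_of_neg {z : ℤ} (hz : z < 0) : encInt z = .minus :: encNat z.natAbs := by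
  rw [encInt, if_pos hz, List.singleton_append]

namespace HasNum

variable {s A : List Letter} {t u : ℕ} {z z' : ℤ}

theorem bit_iff (h : HasNum s t z) (j : ℕ) : NumBit s t j ↔ z.natAbs.testBit j = true := by
  obtain ⟨A, B, hs, ht, hA⟩ := h
  rw [← getElem?_encodeNat]
  rcases lt_or_ge z 0 with hz | hz
  · rw [encInt_of_neg hz, encNat] at hs
    exact numBit_iff (A := A ++ [.minus]) (B := B) (by simp [hs]) (by simp [ht]) (by simp) j
  · rw [encInt_of_nonneg hz, encNat] at hs
    exact numBit_iff (B := B) (by simp [hs]) ht hA.getLast?_ne_bit j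

theorem neg_iff (h : HasNum s t z) : NumNeg s t ↔ z < 0 := by
  obtain ⟨A, B, hs, ht, hA⟩ := h
  rcases lt_or_ge z 0 with hz | hz
  · rw [encInt_of_neg hz, encNat] at hs
    rw [NumNeg, numStart_eq (A := A ++ [.minus]) (B := B) (d := Computability.encodeNat z.natAbs)
      (by simp [hs]) (by simp [ht]) (by simp)]
    simp [hs, hz]
  · rw [encInt_of_nonneg hz, encNat] at hs
    rw [NumNeg, numStart_eq (B := B) (d := Computability.encodeNat z.natAbs) (by simp [hs]) ht
      hA.getLast?_ne_bit]
    refine iff_of_false (fun ⟨hpos, hminus⟩ => ?_) hz.not_gt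
    rw [hs, List.getElem?_append_left (Nat.sub_one_lt hpos.ne'),
      ← List.getLast?_eq_getElem?] at hminus
    exact hA.getLast?_ne_minus hminus

theorem lt_two_pow (h : HasNum s t z) : z.natAbs < 2 ^ s.length := by
  refine Nat.lt_pow_two_of_testBit _ fun j hj => Bool.eq_false_iff.2 fun hbit => ?_
  have hget := ((h.bit_iff j).2 hbit).2
  rw [List.getElem?_eq_none (le_add_left hj)] at hget
  cases hget

theorem eq_iff (h : HasNum s t z) (h' : HasNum s u z') :
    NumEq s t u ↔ z.natAbs = z'.natAbs := by
  simp only [NumEq, h.bit_iff, h'.bit_iff]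
  refine ⟨fun e => Nat.eq_of_testBit_eq fun j => ?_, fun e j _ => by rw [e]⟩
  rcases lt_or_ge j s.length with hj | hj
  · exact Bool.eq_iff_iff.2 (e j hj)
  · have hpow := Nat.pow_le_pow_right two_pos hj
    rw [Nat.testBit_lt_two_pow (h.lt_two_pow.trans_le hpow),
      Nat.testBit_lt_two_pow (h'.lt_two_pow.trans_le hpow)]

theorem append_right (h : HasNum s t z) (B : List Letter) : HasNum (s ++ B) t z := by
  obtain ⟨A, C, rfl, ht, hA⟩ := h
  exact ⟨A, C ++ B, by simp, ht, hA⟩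

theorem append_left (hA : Boundary A) (h : HasNum s t z) :
    HasNum (A ++ s) (A.count .endNum + t) z := by
  obtain ⟨C, B, rfl, rfl, hC⟩ := h
  exact ⟨A ++ C, B, by simp, List.count_append, hA.append hC⟩

end HasNum

theorem hasNum_encInt (z : ℤ) : HasNum (encInt z) 0 z := ⟨[], [], by simp, rfl, .nil⟩

theorem hasNum_encNat (k : ℕ) : HasNum (encNat k) 0 k := by
  have h := hasNum_encInt k
  rwa [encInt_of_nonneg (Int.natCast_nonneg k), Int.natAbs_natCast] at h

theorem count_flatMap_const {β : Type} {g : β → List Letter} {l : Letter} {c : ℕ}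
    (hc : ∀ x, (g x).count l = c) (L : List β) : (L.flatMap g).count l = c * L.length := by
  induction L with
  | nil => simp
  | cons x L ih => rw [List.flatMap_cons, List.count_append, hc, ih, List.length_cons]; ring

theorem HasNum.flatMap_ofFn {β : Type} {g : β → List Letter} {c n t : ℕ} {z : ℤ}
    (hc : ∀ x, (g x).count .endNum = c) (hb : ∀ x, Boundary (g x)) (f : Fin n → β) (i : Fin n)
    (h : HasNum (g (f i)) t z) : HasNum ((List.ofFn f).flatMap g) (c * i + t) z := by
  have hi : (i : ℕ) < (List.ofFn f).length := by simp
  have hsplit := List.take_append_drop i (List.ofFn f)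
  rw [List.drop_eq_getElem_cons hi, List.getElem_ofFn] at hsplit
  have hnum := ((h.append_right (((List.ofFn f).drop (i + 1)).flatMap g)).append_left
    (Boundary.flatMap hb ((List.ofFn f).take i)))
  rwa [count_flatMap_const hc, List.length_take_of_le hi.le, ← List.flatMap_cons,
    ← List.flatMap_append, hsplit] at hnum

theorem boundary_encNat (k : ℕ) : Boundary (encNat k) := .concat_endNum _

theorem boundary_encInt (z : ℤ) : Boundary (encInt z) := by
  rw [encInt, encNat, ← List.append_assoc]
  exact .concat_endNum _

theorem boundary_encPreference {m : ℕ} (p : Preference m) : Boundary (encPreference p) :=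
  .concat_endBlock _

theorem boundary_encVector {m : ℕ} (α : Fin m → ℚ) : Boundary (encVector α) := .concat_endBlock _

theorem Election.boundary_encode (E : Election) : Boundary E.encode := .concat_endBlock _

theorem count_endNum_encNat (k : ℕ) : (encNat k).count .endNum = 1 := by
  rw [encNat, List.count_append, List.count_eq_zero_of_not_mem (by simp),
    List.count_singleton_self]

theorem count_endBlock_encNat (k : ℕ) : (encNat k).count .endBlock = 0 :=
  List.count_eq_zero_of_not_mem (by simp [encNat])

theorem count_endNum_encInt (z : ℤ) : (encInt z).count .endNum = 1 := by
  rw [encInt, List.count_append, count_endNum_encNat]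
  split_ifs <;> simp

theorem count_endBlock_encInt (z : ℤ) : (encInt z).count .endBlock = 0 := by
  rw [encInt, List.count_append, count_endBlock_encNat]
  split_ifs <;> simp

theorem encPreference_eq {m : ℕ} (p : Preference m) :
    encPreference p = (List.ofFn fun i => (p.symm i : ℕ)).flatMap encNat ++ [.endBlock] := by
  unfold encPreference
  congr 1
  change ((List.ofFn fun i => p.symm i).flatMap fun a : Fin m => [a.val]).flatMap encNat = _
  rw [← List.map_eq_flatMap, List.map_ofFn]
  rfl

theorem count_endNum_encPreference {m : ℕ} (p : Preference m) :
    (encPreference p).count .endNum = m := by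
  rw [encPreference_eq, List.count_append, count_flatMap_const count_endNum_encNat]
  simp

theorem count_endBlock_encPreference {m : ℕ} (p : Preference m) :
    (encPreference p).count .endBlock = 1 := by
  rw [encPreference_eq, List.count_append, count_flatMap_const count_endBlock_encNat]
  simp

theorem hasNum_encPreference {m : ℕ} (p : Preference m) (i : Fin m) :
    HasNum (encPreference p) i (p.symm i : ℕ) := by
  have h := (HasNum.flatMap_ofFn count_endNum_encNat boundary_encNat
    (fun i => (p.symm i : ℕ)) i (hasNum_encNat _)).append_right [.endBlock]
  rwa [← encPreference_eq, one_mul, add_zero] at h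

/-- The numerator of the entry `i` of the scoring vector over the common denominator. -/
def scoreNum {m : ℕ} (α : Fin m → ℚ) (i : Fin m) : ℤ := (α i * commonDen α).num

/-- The encoding of the scoring vector without the end mark of the block. -/
def vectorBody {m : ℕ} (α : Fin m → ℚ) : List Letter :=
  encNat (commonDen α) ++ (List.ofFn (scoreNum α)).flatMap encInt

theorem encVector_eq {m : ℕ} (α : Fin m → ℚ) : encVector α = vectorBody α ++ [.endBlock] := rfl

theorem count_endNum_vectorBody {m : ℕ} (α : Fin m → ℚ) :
    (vectorBody α).count .endNum = 1 + m := by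
  rw [vectorBody, List.count_append, count_endNum_encNat,
    count_flatMap_const count_endNum_encInt, one_mul, List.length_ofFn]

theorem count_endBlock_vectorBody {m : ℕ} (α : Fin m → ℚ) :
    (vectorBody α).count .endBlock = 0 := by
  rw [vectorBody, List.count_append, count_endBlock_encNat,
    count_flatMap_const count_endBlock_encInt, zero_mul, add_zero]

theorem count_endNum_encVector {m : ℕ} (α : Fin m → ℚ) :
    (encVector α).count .endNum = 1 + m := by
  rw [encVector_eq, List.count_append, count_endNum_vectorBody]
  simp

theorem hasNum_encVector {m : ℕ} (α : Fin m → ℚ) (i : Fin m) :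
    HasNum (encVector α) (1 + i) (scoreNum α i) := by
  have h := ((HasNum.flatMap_ofFn count_endNum_encInt boundary_encInt (scoreNum α) i
    (hasNum_encInt _)).append_left (boundary_encNat (commonDen α))).append_right [.endBlock]
  rwa [count_endNum_encNat, one_mul, add_zero] at h

theorem Election.count_endNum_encode (E : Election) :
    E.encode.count .endNum = 1 + E.m + E.m * (E.n + 1) := by
  rw [Election.encode, List.count_append, List.count_append, List.count_append,
    count_endNum_encVector, count_endNum_encPreference,
    count_flatMap_const count_endNum_encPreference, List.length_ofFn]
  simp
  ring

theorem Election.count_endBlock_encode (E : Election) : E.encode.count .endBlock = E.n + 3 := by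
  rw [Election.encode, List.count_append, List.count_append, List.count_append, encVector_eq,
    List.count_append, count_endBlock_vectorBody, count_endBlock_encPreference,
    count_flatMap_const count_endBlock_encPreference, List.length_ofFn]
  simp
  ring

theorem candCount_eq {s V B : List Letter} {m : ℕ} (hs : s = V ++ .endBlock :: B)
    (hblock : V.count .endBlock = 0) (hnum : V.count .endNum = 1 + m) : candCount s = m := by
  rw [candCount, occPos_eq hs hblock, hs, List.take_left, hnum, Nat.add_sub_cancel_left]

/-- The numbers of candidates and the numbers with the indices used by the decision procedure can
be read off from the word `s` for the election `E`. -/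
structure Reads (s : List Letter) (E : Election) : Prop where
  cand : candCount s = E.m
  score : ∀ i : Fin E.m, HasNum s (1 + i) (scoreNum E.α i)
  tie : ∀ a : Fin E.m, HasNum s (1 + E.m + a) (E.tie.symm a : ℕ)
  vote : ∀ (w : Fin E.n) (i : Fin E.m),
    HasNum s (1 + E.m + E.m * (w + 1) + i) ((E.profile w).symm i : ℕ)

theorem Election.reads_encode (E : Election) (B : List Letter) : Reads (E.encode ++ B) E where
  cand := by
    refine candCount_eq (V := vectorBody E.α) (B := encPreference E.tie ++
      (List.ofFn E.profile).flatMap encPreference ++ [.endBlock] ++ B) ?_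
      (count_endBlock_vectorBody _) (count_endNum_vectorBody _)
    simp [Election.encode, encVector_eq]
  score i :=
    ((((hasNum_encVector E.α i).append_right _).append_right _).append_right _).append_right _
  tie a := by
    have h := (hasNum_encPreference E.tie a).append_left (boundary_encVector E.α)
    rw [count_endNum_encVector] at h
    exact ((h.append_right _).append_right _).append_right _
  vote w i := by
    have h := (HasNum.flatMap_ofFn count_endNum_encPreference boundary_encPreference E.profile w
      (hasNum_encPreference _ i)).append_left
      ((boundary_encVector E.α).append (boundary_encPreference E.tie))
    rw [List.count_append, count_endNum_encVector, count_endNum_encPreference] at h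
    have hidx : 1 + E.m + E.m + (E.m * w + i) = 1 + E.m + E.m * (w + 1) + i := by ring
    exact hidx ▸ (h.append_right [.endBlock]).append_right B

end Encoding

section Correctness

open Finset

/-! ### Comparing sums digit by digit -/

open Classical in
/-- The binary digit `j` of the number with index `t`, with the sign of that number. -/
noncomputable def signedBit (s : List Letter) (t j : ℕ) : ℤ :=
  if NumBit s t j then if NumNeg s t then -1 else 1 else 0

theorem column_sub_column (s : List Letter) (n : ℕ) (f g : ℕ → ℕ) (j : ℕ) :
    (column s n f g j : ℤ) - column s n g f j =
      ∑ w ∈ range n, (signedBit s (f w) j - signedBit s (g w) j) := by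
  simp only [column, Nat.count_eq_card_filter_range, card_filter, Nat.cast_add, Nat.cast_sum,
    ← sum_add_distrib, ← sum_sub_distrib]
  refine sum_congr rfl fun w _ => ?_
  unfold signedBit
  by_cases hfn : NumNeg s (f w) <;> by_cases hgn : NumNeg s (g w) <;>
    by_cases hf : NumBit s (f w) j <;> by_cases hg : NumBit s (g w) j <;> simp [*]

theorem carry_sub_eq (s : List Letter) (n : ℕ) (f g : ℕ → ℕ) (J : ℕ) :
    (carry s n f g J : ℤ) - 2 * n =
      (∑ j ∈ range J, ((column s n f g j : ℤ) - column s n g f j) * 2 ^ j) / 2 ^ J := by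
  induction J with
  | zero => simp [carry]
  | succ J ih =>
    have hle := column_le s n g f J
    rw [sum_range_succ, pow_succ, ← Int.ediv_ediv_of_nonneg (by positivity),
      Int.add_mul_ediv_right _ _ (by positivity), ← ih, carry]
    omega

theorem sum_testBit (k J : ℕ) : ∑ j ∈ range J, (k.testBit j).toNat * 2 ^ j = k % 2 ^ J := by
  induction J with
  | zero => simp [Nat.mod_one]
  | succ J ih => rw [sum_range_succ, ih, Nat.mod_pow_succ, Nat.toNat_testBit, mul_comm (2 ^ J)]

theorem HasNum.sum_signedBit {s : List Letter} {t : ℕ} {z : ℤ} (h : HasNum s t z) :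
    ∑ j ∈ range s.length, signedBit s t j * 2 ^ j = z := by
  have hbit (j : ℕ) : signedBit s t j = z.sign * (z.natAbs.testBit j).toNat := by
    simp only [signedBit, h.bit_iff, h.neg_iff]
    rcases lt_trichotomy z 0 with hz | rfl | hz
    · cases z.natAbs.testBit j <;> simp [hz, Int.sign_eq_neg_one_of_neg]
    · simp
    · cases z.natAbs.testBit j <;> simp [hz.not_gt, Int.sign_eq_one_of_pos hz]
  have habs := sum_testBit z.natAbs s.length
  rw [Nat.mod_eq_of_lt h.lt_two_pow] at habs
  simp only [hbit, mul_assoc, ← mul_sum]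
  exact_mod_cast habs ▸ Int.sign_mul_natAbs z

theorem sumLT_iff {s : List Letter} {n : ℕ} {f g : ℕ → ℕ} {zf zg : Fin n → ℤ}
    (hf : ∀ w : Fin n, HasNum s (f w) (zf w)) (hg : ∀ w : Fin n, HasNum s (g w) (zg w)) :
    SumLT s n f g ↔ ∑ w, zf w < ∑ w, zg w := by
  have hcarry := carry_sub_eq s n f g s.length
  have hsum : ∑ j ∈ range s.length, ((column s n f g j : ℤ) - column s n g f j) * 2 ^ j =
      ∑ w, zf w - ∑ w, zg w := by
    simp only [column_sub_column, sum_mul]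
    rw [sum_comm, sum_range, ← sum_sub_distrib]
    refine sum_congr rfl fun w _ => ?_
    rw [← (hf w).sum_signedBit, ← (hg w).sum_signedBit, ← sum_sub_distrib]
    exact sum_congr rfl fun j _ => sub_mul ..
  rw [hsum] at hcarry
  have hneg := Int.ediv_nonneg_iff_of_pos (a := ∑ w, zf w - ∑ w, zg w)
    (b := 2 ^ s.length) (by positivity)
  rw [← hcarry] at hneg
  rw [SumLT]
  omega

theorem commonDen_pos {m : ℕ} (α : Fin m → ℚ) : 0 < commonDen α :=
  Nat.pos_of_ne_zero fun h => by
    obtain ⟨i, -, hi⟩ := Finset.lcm_eq_zero_iff.1 h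
    exact (α i).den_nz hi

theorem scoreNum_cast {m : ℕ} (α : Fin m → ℚ) (i : Fin m) :
    (scoreNum α i : ℚ) = α i * commonDen α := by
  obtain ⟨k, hk⟩ : (α i).den ∣ commonDen α := Finset.dvd_lcm (Finset.mem_univ i)
  have hint : α i * commonDen α = ((α i).num * k : ℤ) := by
    rw [hk, Nat.cast_mul, ← mul_assoc, Rat.mul_den_eq_num]
    push_cast
    rfl
  rw [scoreNum, hint, Rat.num_intCast]

theorem sum_scoreNum_lt_iff {ι : Type*} [Fintype ι] {m : ℕ} (α : Fin m → ℚ) (f g : ι → Fin m) :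
    ∑ w, scoreNum α (f w) < ∑ w, scoreNum α (g w) ↔ ∑ w, α (f w) < ∑ w, α (g w) := by
  rw [← Int.cast_lt (R := ℚ)]
  simp only [Int.cast_sum, scoreNum_cast, ← sum_mul]
  exact mul_lt_mul_iff_left₀ (Nat.cast_pos.2 (commonDen_pos α))

/-! ### Correctness of the decision procedure -/

theorem forall_lt_iff_forall_perm {m : ℕ} (t : Equiv.Perm (Fin m)) {p : ℕ → Prop} :
    (∀ c < m, p c) ↔ ∀ c, p (t c) :=
  ⟨fun h c => h _ (t c).2, fun h c hc => by simpa using h (t.symm ⟨c, hc⟩)⟩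

theorem exists_lt_iff_exists_perm {m : ℕ} (t : Equiv.Perm (Fin m)) {p : ℕ → Prop} :
    (∃ c < m, p c) ↔ ∃ c, p (t c) :=
  ⟨fun ⟨c, hc, h⟩ => ⟨t.symm ⟨c, hc⟩, by simpa using h⟩, fun ⟨c, h⟩ => ⟨t c, (t c).2, h⟩⟩

theorem count_eq_card_filter_perm {m : ℕ} (t : Equiv.Perm (Fin m)) (p : ℕ → Prop)
    [DecidablePred p] : Nat.count p m = #{c | p (t c)} := by
  rw [Nat.count_eq_card_filter_range, card_filter, card_filter, sum_range]
  exact (Equiv.sum_comp t fun c : Fin m => if p c then 1 else 0).symm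

namespace Reads

variable {s : List Letter} {E : Election}

theorem votePos_eq (R : Reads s E) (w : Fin E.n) (a : Fin E.m) :
    votePos s w (E.tie a) = E.profile w a := by
  have heq (i : Fin E.m) : NumEq s (voteIdx s w i) (candIdx s (E.tie a)) ↔ E.profile w a = i := by
    rw [voteIdx, candIdx, R.cand, (R.vote w i).eq_iff (R.tie _), Equiv.symm_apply_apply,
      Int.natAbs_natCast, Int.natAbs_natCast, Fin.val_inj, Equiv.symm_apply_eq, eq_comm]
  rw [votePos, R.cand, sum_range]
  simp [heq]

theorem hasNum_scoreIdx (R : Reads s E) (v : ℕ) (a i : Fin E.m) (w : Fin E.n) :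
    HasNum s (scoreIdx s v (E.tie a) i w)
      (scoreNum E.α (if (w : ℕ) = v then i else E.profile w a)) := by
  rw [scoreIdx, R.votePos_eq]
  split_ifs <;> exact R.score _

theorem ahead_iff (R : Reads s E) (v : ℕ) (b p a i : Fin E.m) :
    Ahead s E.n v (E.tie b) p (E.tie a) i ↔
      Outranks E.tie b a (movedScore E.α E.profile v b p) (movedScore E.α E.profile v a i) := by
  rw [Ahead, sumLT_iff (R.hasNum_scoreIdx v a i) (R.hasNum_scoreIdx v b p),
    sumLT_iff (R.hasNum_scoreIdx v b p) (R.hasNum_scoreIdx v a i), sum_scoreNum_lt_iff,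
    sum_scoreNum_lt_iff, not_lt]
  rfl

theorem wins_iff (R : Reads s E) (x : Fin E.m) :
    Wins s E.n (E.tie x) ↔ E.rule E.profile = x := by
  have hahead (c : Fin E.m) := R.ahead_iff E.n x ⟨0, E.m_pos⟩ c ⟨0, E.m_pos⟩
  simp only [movedScore_of_le _ le_rfl] at hahead
  rw [Wins, R.cand, forall_lt_iff_forall_perm E.tie, Election.rule, scoringRule_eq_iff]
  simp only [ne_eq, Fin.val_inj, E.tie.injective.eq_iff, hahead]

open Classical in
theorem placeable_iff (R : Reads s E) (v : ℕ) (x y p q : Fin E.m) :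
    Placeable s E.n v (E.tie x) (E.tie y) p q ↔
      ∀ i, i ≠ p → i ≠ q → #{j | j ≤ i ∧ j ≠ p ∧ j ≠ q} ≤
        #{c | Outranks E.tie y c (movedScore E.α E.profile v y p)
          (movedScore E.α E.profile v c i) ∧ c ≠ x ∧ c ≠ y} := by
  have hpos (i : Fin E.m) : Nat.count (fun j => j ≤ i ∧ j ≠ p ∧ j ≠ q) E.m =
      #{j | j ≤ i ∧ j ≠ p ∧ j ≠ q} := by
    rw [count_eq_card_filter_perm (Equiv.refl _)]
    simp only [Equiv.refl_apply, ne_eq, Fin.val_inj, Fin.val_fin_le]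
  have hcand (i : Fin E.m) :
      Nat.count (fun c => Ahead s E.n v (E.tie y) p c i ∧ c ≠ E.tie x ∧ c ≠ E.tie y) E.m =
        #{c | Outranks E.tie y c (movedScore E.α E.profile v y p)
          (movedScore E.α E.profile v c i) ∧ c ≠ x ∧ c ≠ y} := by
    rw [count_eq_card_filter_perm E.tie]
    simp only [R.ahead_iff, ne_eq, Fin.val_inj, E.tie.injective.eq_iff]
  rw [Placeable, R.cand, forall_lt_iff_forall_perm (Equiv.refl _)]
  refine forall_congr' fun i => imp_congr Fin.val_ne_iff (imp_congr Fin.val_ne_iff ?_)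
  rw [← hpos, ← hcand]
  rfl

theorem suspect_iff (R : Reads s E) (v : Fin E.n) (y : Fin E.m) :
    Suspect s E.n v (E.tie y) ↔ IsCoalitionAgainst E.rule E.profile {v} y := by
  rw [isCoalitionAgainst_singleton, Suspect, R.cand, exists_lt_iff_exists_perm E.tie]
  simp only [R.wins_iff, ne_eq, Fin.val_inj, E.tie.injective.eq_iff]
  constructor
  · rintro ⟨x, hw, hxy, p, hp, q, hqp, h⟩
    have hq := hqp.trans hp
    obtain ⟨Q, hQx, hQy, hr⟩ := (exists_vote_iff_card_le E.m_pos E.α_antitone E.tie E.profile v hxy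
      (p := ⟨p, hp⟩) (q := ⟨q, hq⟩) (Fin.ne_of_lt hqp)).2
      ⟨(R.ahead_iff v y ⟨p, hp⟩ x ⟨q, hq⟩).1 h.1, (R.placeable_iff v x y ⟨p, hp⟩ ⟨q, hq⟩).1 h.2⟩
    exact ⟨hw ▸ Ne.symm hxy, Q, by rwa [hw, hQx, hQy], hr⟩
  · rintro ⟨hy, Q, hQ, hr⟩
    obtain ⟨hx, hcard⟩ := (exists_vote_iff_card_le E.m_pos E.α_antitone E.tie E.profile v
      (Ne.symm hy) hQ.ne).1 ⟨Q, rfl, rfl, hr⟩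
    exact ⟨_, rfl, Ne.symm hy, Q y, (Q y).2, Q _, hQ, (R.ahead_iff ..).2 hx,
      (R.placeable_iff ..).2 hcard⟩

theorem isGiven_iff (R : Reads s E) {y : Fin E.m}
    (hy : HasNum s (1 + E.m + E.m * (E.n + 1)) (y : ℕ)) (a : Fin E.m) :
    IsGiven s E.n (E.tie a) ↔ a = y := by
  rw [IsGiven, candIdx, voteIdx, R.cand, add_zero, (R.tie _).eq_iff hy, Equiv.symm_apply_apply,
    Int.natAbs_natCast, Int.natAbs_natCast, Fin.val_inj]

theorem exists_suspect_iff (R : Reads s E) (v : Fin E.n) :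
    (∃ y < candCount s, Suspect s E.n v y) ↔ IsCoalition E.rule E.profile {v} := by
  simp only [R.cand, exists_lt_iff_exists_perm E.tie, R.suspect_iff, IsCoalition]

theorem exists_given_suspect_iff (R : Reads s E) {y : Fin E.m}
    (hy : HasNum s (1 + E.m + E.m * (E.n + 1)) (y : ℕ)) (v : Fin E.n) :
    (∃ a < candCount s, IsGiven s E.n a ∧ Suspect s E.n v a) ↔
      IsCoalitionAgainst E.rule E.profile {v} y := by
  simp only [R.cand, exists_lt_iff_exists_perm E.tie, R.suspect_iff, R.isGiven_iff hy,
    exists_eq_left]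

end Reads

theorem voterCount_eq {E : Election} {B : List Letter} {k : ℕ} (hk : B.count .endBlock + 3 = k) :
    voterCount (E.encode ++ B) k = E.n := by
  rw [voterCount, List.count_append, E.count_endBlock_encode]
  omega

theorem member_iff {E : Election} (M : Finset (Fin E.n)) (B : List Letter) (v : Fin E.n) :
    Member (E.encode ++ (encVoters M ++ B)) E.n v ↔ v ∈ M := by
  obtain ⟨A, hA⟩ : ∃ A, E.encode = A ++ [.endBlock] := ⟨_, rfl⟩
  have hcount : A.count .endBlock = E.n + 2 := by
    have h := E.count_endBlock_encode
    rw [hA, List.count_append, List.count_singleton_self] at h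
    omega
  have hidx : A.length + 1 + v = (A ++ [Letter.endBlock]).length + v := by simp
  rw [Member, occPos_eq (P := A) (B := encVoters M ++ B) (by simp [hA]) hcount, hA, hidx,
    List.getElem?_append_right (Nat.le_add_right ..), Nat.add_sub_cancel_left, encVoters,
    List.append_assoc, List.getElem?_append_left (by simp)]
  simp

theorem Election.hasNum_encode_append (E : Election) {C : List Letter} (hC : Boundary C)
    (hcount : C.count .endNum = 0) (k : ℕ) (B : List Letter) :
    HasNum (E.encode ++ (C ++ (encNat k ++ B))) (1 + E.m + E.m * (E.n + 1)) k := by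
  have h := ((hasNum_encNat k).append_right B).append_left (E.boundary_encode.append hC)
  rwa [List.count_append, E.count_endNum_encode, hcount, List.append_assoc] at h

theorem count_endNum_encVoters {n : ℕ} (M : Finset (Fin n)) : (encVoters M).count .endNum = 0 :=
  List.count_eq_zero_of_not_mem (by simp [encVoters])

theorem count_endBlock_encVoters {n : ℕ} (M : Finset (Fin n)) :
    (encVoters M).count .endBlock = 1 := by
  rw [encVoters, List.count_append, List.count_eq_zero_of_not_mem (by simp)]
  simp

theorem exists_lt_member_iff {E : Election} {M : Finset (Fin E.n)} {B : List Letter}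
    {p : ℕ → Prop} {yes : Finset (Fin E.n) → Prop} (hM : #M = 1)
    (hp : ∀ v : Fin E.n, p v ↔ yes {v}) :
    (∃ v < E.n, Member (E.encode ++ (encVoters M ++ B)) E.n v ∧ p v) ↔ yes M := by
  obtain ⟨u, rfl⟩ := card_eq_one.1 hM
  simp only [exists_lt_iff_exists_perm (Equiv.refl _), Equiv.refl_apply, member_iff, mem_singleton,
    hp, exists_eq_left]

theorem exists_card_le_one_iff {β : Type*} {p : Finset β → Prop} (hp : ¬ p ∅) :
    (∃ M, #M ≤ 1 ∧ p M) ↔ ∃ v, p {v} := by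
  refine ⟨fun ⟨M, hM, h⟩ => ?_, fun ⟨v, h⟩ => ⟨{v}, (card_singleton v).le, h⟩⟩
  rcases Nat.le_one_iff_eq_zero_or_eq_one.1 hM with hM | hM
  · exact absurd (card_eq_zero.1 hM ▸ h) hp
  · obtain ⟨v, rfl⟩ := card_eq_one.1 hM
    exact ⟨v, h⟩

theorem CPMW.decide_iff (I : CPMW) (hI : #I.M = 1) : DecideCPMW I.encode ↔ I.IsYes := by
  have henc : I.encode = I.toElection.encode ++ (encVoters I.M ++ (encNat I.y ++ [])) := by
    simp [CPMW.encode]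
  have hn : voterCount I.encode 4 = I.n := by
    rw [henc]
    exact voterCount_eq (by simp [count_endBlock_encVoters, count_endBlock_encNat])
  have hy := I.toElection.hasNum_encode_append (C := encVoters I.M) (.concat_endBlock _)
    (count_endNum_encVoters _) I.y []
  rw [DecideCPMW, hn, henc]
  exact exists_lt_member_iff (yes := fun M => IsCoalitionAgainst I.rule I.profile M I.y) hI
    ((I.toElection.reads_encode _).exists_given_suspect_iff hy)

theorem CPM.decide_iff (I : CPM) (hI : #I.M = 1) : DecideCPM I.encode ↔ I.IsYes := by
  have henc : I.encode = I.toElection.encode ++ (encVoters I.M ++ []) := by simp [CPM.encode]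
  have hn : voterCount I.encode 4 = I.n := by
    rw [henc]
    exact voterCount_eq (by simp [count_endBlock_encVoters])
  rw [DecideCPM, hn, henc]
  exact exists_lt_member_iff hI (I.toElection.reads_encode _).exists_suspect_iff

theorem CPMSW.decide_iff (I : CPMSW) (hI : I.k = 1) : DecideCPMSW I.encode ↔ I.IsYes := by
  have henc : I.encode = I.toElection.encode ++ ([] ++ (encNat I.y ++ encNat I.k)) := by
    simp [CPMSW.encode]
  have hn : voterCount I.encode 3 = I.n := by
    rw [henc]
    exact voterCount_eq (by simp [count_endBlock_encNat])
  have hy := I.toElection.hasNum_encode_append .nil List.count_nil I.y (encNat I.k)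
  rw [DecideCPMSW, hn, henc, CPMSW.IsYes, hI,
    exists_card_le_one_iff (not_isCoalitionAgainst_empty _ _ _),
    exists_lt_iff_exists_perm (Equiv.refl _)]
  exact exists_congr (I.toElection.reads_encode _ |>.exists_given_suspect_iff (hI ▸ hy))

theorem CPMS.decide_iff (I : CPMS) (hI : I.k = 1) : DecideCPMS I.encode ↔ I.IsYes := by
  have hn : voterCount I.encode 3 = I.n := voterCount_eq (by rw [count_endBlock_encNat])
  rw [DecideCPMS, hn, CPMS.IsYes, hI,
    exists_card_le_one_iff fun ⟨y, hy⟩ => not_isCoalitionAgainst_empty _ _ y hy,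
    exists_lt_iff_exists_perm (Equiv.refl _)]
  exact exists_congr (I.toElection.reads_encode _).exists_suspect_iff

instance : Inhabited Letter := ⟨.minus⟩

end Correctness

end PossibleManipulators

theorem mainTheorem1 :
    PossibleManipulators.InP
      (fun I : {I : PossibleManipulators.CPMW // I.M.card = 1} => I.1.encode)
      (fun I => I.1.IsYes) ∧
    PossibleManipulators.InP
      (fun I : {I : PossibleManipulators.CPM // I.M.card = 1} => I.1.encode)
      (fun I => I.1.IsYes) ∧
    PossibleManipulators.InP
      (fun I : {I : PossibleManipulators.CPMSW // I.k = 1} => I.1.encode)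
      (fun I => I.1.IsYes) ∧
    PossibleManipulators.InP
      (fun I : {I : PossibleManipulators.CPMS // I.k = 1} => I.1.encode)
      (fun I => I.1.IsYes) := by
  open PossibleManipulators in
  exact ⟨PolyTimePred.decideCPMW.inP fun I => I.1.decide_iff I.2,
    PolyTimePred.decideCPM.inP fun I => I.1.decide_iff I.2,
    PolyTimePred.decideCPMSW.inP fun I => I.1.decide_iff I.2,
    PolyTimePred.decideCPMS.inP fun I => I.1.decide_iff I.2⟩
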